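/- Setting. Fix constants $B,N_0,P_t,G_t,\sigma_{\rm rcs},A_{\rm eff},d>0$, an integer $M\ge 1$, $\gamma\in(0,1)$, $\mu_T\in\mathbb C$ and $\sigma_T^2\ge 0$ with $(\mu_T,\sigma_T^2)\neq(0,0)$. Let $X$ have the Bernoulli–Gaussian law $(1-\gamma)\delta_0+\gamma\,\mathcal{CN}(\mu_T,\sigma_T^2)$, let $Z\sim\mathcal{CN}(0,1)$ be independent of $X$, and for $s\ge 0$ let $R(s)=I(X;\sqrt{s}\,X+Z)$ be the mutual information in bits. For $\lambda\in[0,1]$ put $$\mathsf{snr}_c(\lambda)=\frac{P_t}{(1-\lambda)BN_0},\qquad \overline{\mathsf{snr}}_s(\lambda)=\frac{M}{\lambda BN_0}\,\frac{P_tG_t\sigma_{\rm rcs}A_{\rm eff}}{(4\pi)^2d^4},$$ $$R_c(\lambda)=(1-\lambda)B\log_2\bigl(1+\mathsf{snr}_c(\lambda)\bigr),\qquad \bar R_s(\lambda)=\lambda B\,R\bigl(\overline{\mathsf{snr}}_s(\lambda)\bigr),$$ with $R_c(1)=0$ and $\bar R_s(0)=0$ (the limiting values). Let $w_s,w_c\ge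 0$, not both zero, and $\bar R_{\rm sum}=w_s\bar R_s+w_cR_c$. Derivatives at the endpoints $0$ and $1$ are one-sided. Theorem. The mutual information $R(s)$ is finite for every $s\ge0$, and $\bar R_s$ and $R_c$ are differentiable on $(0,1)$. The problem of maximizing $\bar R_{\rm sum}$ over $[0,1]$ has exactly one solution $\bar\lambda^\star$, and $\bar\lambda^\star$ satisfies the Karush–Kuhn–Tucker conditions of this problem. Moreover: 1. If $\lambda\in[0,1]$ is a point at which $\bar R_s$ and $R_c$ are differentiable and $w_s\bar R_s'(\lambda)+w_cR_c'(\lambda)=0$, then $\lambda=\bar\lambda^\star$. 2. If there is no such point in $[0,1]$, then either $w_s\bar R_s'>-w_cR_c'$ on all of $(0,1)$ or $w_s\bar R_s'<-w_cR_c'$ on all of $(0,1)$; and $\bar\lambda^\star=1$ if $w_s\bar R_s'(\lambda)>-w_cR_c'(\lambda)$ at some $\lambda\in[0,1]$ where both derivatives exist, while $\bar\lambda^\star=0$ if $w_s\bar R_s'(\lambda)<-w_cR_c'(\lambda)$ at some such $\lambda$. 3. On $[0,1]$, $\bar R_s$ is strictly increasing and concave in $\lambda$, and $R_c$ is strictly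 decreasing and concave in $\lambda$. -/

import Mathlib

open MeasureTheory ProbabilityTheory Set
open scoped NNReal ENNReal

noncomputable section

namespace ISAC

/-- The circularly symmetric complex Gaussian law `CN(m, v)`: the real and imaginary parts are
independent real Gaussians with means `Re m`, `Im m` and variance `v / 2` each.  For `v = 0` this
is the point mass at `m`. -/
def complexGaussian (m : ℂ) (v : ℝ≥0) : Measure ℂ :=
  ((gaussianReal m.re (v / 2)).prod (gaussianReal m.im (v / 2))).map
    (fun q : ℝ × ℝ => (⟨q.1, q.2⟩ : ℂ))

/-- The Bernoulli-Gaussian law `BG(m, v, γ) = (1 - γ) δ₀ + γ CN(m, v)`. -/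
def bernoulliGaussian (m : ℂ) (v : ℝ≥0) (γ : ℝ) : Measure ℂ :=
  ENNReal.ofReal (1 - γ) • Measure.dirac 0 + ENNReal.ofReal γ • complexGaussian m v

/-- The joint law of `(X, Y)` where `Y = √s X + Z`, `X` has law `P` and `Z ∼ CN(0, 1)` is
independent of `X`. -/
def channelLaw (P : Measure ℂ) (s : ℝ) : Measure (ℂ × ℂ) :=
  (P.prod (complexGaussian 0 1)).map
    (fun q : ℂ × ℂ => (q.1, (Real.sqrt s : ℂ) * q.1 + q.2))

/-- Mutual information (in nats) of a pair of random variables with joint law `Q`: the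
Kullback-Leibler divergence of the joint law from the product of its marginals. -/
def mutualInfo (Q : Measure (ℂ × ℂ)) : ℝ≥0∞ :=
  InformationTheory.klDiv Q (Q.fst.prod Q.snd)

/-- Parameters of the integrated radar and communication system. -/
structure Params where
  /-- total bandwidth -/
  B : ℝ
  /-- noise spectral density -/
  N₀ : ℝ
  /-- transmit power -/
  Pt : ℝ
  /-- transmit antenna gain -/
  Gt : ℝ
  /-- radar cross-section -/
  σrcs : ℝ
  /-- effective area of the receiving antenna -/
  Aeff : ℝ
  /-- average distance from the farthest range bin to the receiver -/
  d : ℝ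
  /-- number of pulses -/
  M : ℕ
  /-- probability of target presence -/
  γ : ℝ
  /-- mean of the complex target amplitude -/
  μT : ℂ
  /-- variance of the complex target amplitude -/
  σT2 : ℝ≥0
  B_pos : 0 < B
  N₀_pos : 0 < N₀
  Pt_pos : 0 < Pt
  Gt_pos : 0 < Gt
  σrcs_pos : 0 < σrcs
  Aeff_pos : 0 < Aeff
  d_pos : 0 < d
  M_pos : 0 < M
  γ_mem : γ ∈ Ioo (0 : ℝ) 1
  /-- the amplitude of a present target is not identically zero -/
  target_ne_zero : μT ≠ 0 ∨ 0 < σT2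

namespace Params

variable (p : Params)

/-- Mutual information (in nats) between the target signal and the observation in one
range-Doppler bin at signal-to-noise ratio `s`. -/
def binInfo (s : ℝ) : ℝ≥0∞ :=
  mutualInfo (channelLaw (bernoulliGaussian p.μT p.σT2 p.γ) s)

/-- Sensing rate `R(s) = I(X; √s X + Z)` of one range-Doppler bin, in bits. -/
def binRate (s : ℝ) : ℝ :=
  (p.binInfo s).toReal / Real.log 2

/-- Signal-to-noise ratio of the communication system when the radar gets the fraction `t` of the
bandwidth. -/
def snrC (t : ℝ) : ℝ :=
  p.Pt / ((1 - t) * p.B * p.N₀)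

/-- Common (smallest) signal-to-noise ratio of the range bins when the radar gets the fraction `t`
of the bandwidth. -/
def snrS (t : ℝ) : ℝ :=
  p.M / (t * p.B * p.N₀) * (p.Pt * p.Gt * p.σrcs * p.Aeff / ((4 * Real.pi) ^ 2 * p.d ^ 4))

/-- Communication rate.  At `t = 1` the value is `0`, the limit for `t → 1`. -/
def rateC (t : ℝ) : ℝ :=
  (1 - t) * p.B * Real.logb 2 (1 + p.snrC t)

/-- Simplified sensing rate.  At `t = 0` the value is `0`, the limit for `t → 0`. -/
def rateS (t : ℝ) : ℝ :=
  t * p.B * p.binRate (p.snrS t)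

/-- The simplified weighted sum of the rates. -/
def rateSum (ws wc t : ℝ) : ℝ :=
  ws * p.rateS t + wc * p.rateC t

/-- `t` is a point of `[0, 1]` where both rates are differentiable (one-sidedly at `0` and at `1`)
and the weighted derivatives cancel. -/
def IsStationary (ws wc t : ℝ) : Prop :=
  t ∈ Icc (0 : ℝ) 1 ∧ ∃ a b : ℝ, HasDerivWithinAt p.rateS a (Icc 0 1) t ∧
    HasDerivWithinAt p.rateC b (Icc 0 1) t ∧ ws * a + wc * b = 0

end Params

/-- The Karush-Kuhn-Tucker conditions at `t` for maximizing `f` subject to `0 ≤ t` and `t ≤ 1`: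
primal feasibility, stationarity of the Lagrangian, dual feasibility, complementary slackness. -/
def IsKKT (f : ℝ → ℝ) (t : ℝ) : Prop :=
  t ∈ Icc (0 : ℝ) 1 ∧ ∃ D η₀ η₁ : ℝ, HasDerivWithinAt f D (Icc 0 1) t ∧
    D + η₀ - η₁ = 0 ∧ 0 ≤ η₀ ∧ 0 ≤ η₁ ∧ η₀ * t = 0 ∧ η₁ * (1 - t) = 0

end ISAC

end

noncomputable section

namespace ISAC

/-! ### Real Gaussian measures and exponential tilts -/

/-! Everything rests on strict concavity of `R`. Multiplying the channel output by `√s` turns it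
into the value at time `s` of the process `Y_s = s X + W_s`, with `W` a complex Brownian motion. Its
density with respect to `CN(0, s)` is the averaged likelihood ratio `F_s = avgTilt P s`, and in nats
the mutual information is `s E|X|² - D(s)`, where `D = outputDiv P` is the mean of `log F_s(Y_s)`
(`mutualInfo_channelLaw`). The linear term does not affect concavity, so `D` has to be strictly
convex.

Let `A`, `B`, `C` be consecutive increments of `Y` of durations `s`, `t`, `r`. Their joint density
depends only on `A + B + C`, so `A + C` has the law of `Y_{s+r}`. Therefore `D(s+t+r) + D(s) -
D(s+t) - D(s+r)` is the conditional mutual information of `B` and `C` given `A`, hence nonnegative.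
It vanishes only if `F` factorizes, which the Bernoulli-Gaussian formula for `F` excludes
(`outputDiv_add_lt`, `outputDiv_add_lt_add`). With differentiability of `D`
(`differentiableAt_outputDiv`) this gives strict concavity (`strictConcaveOn_of_increments`).
Comparison with a Gaussian prior gives logarithmic growth (`le_outputDiv`).

A nonnegative, strictly concave, differentiable `r` of sublinear growth (`IsRateCurve`) has a
perspective `τ ↦ τ r(k/τ)` that is strictly increasing, strictly concave and continuous down to `τ =
0`. Up to the factor `B`, the sensing rate is such a perspective in `λ` and the communication rate
one in `1 - λ`, with `r = log₂(1 + ·)`. The weighted sum is thus continuous and strictly concave on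
a compact interval, and the remaining claims are one-variable convex optimization. At an endpoint
maximizer the one-sided derivative is finite because the slopes are monotone and maximality bounds
them. -/

theorem lintegral_gaussianReal {v : ℝ≥0} (hv : v ≠ 0) (m : ℝ) {f : ℝ → ℝ≥0∞}
    (hf : Measurable f) :
    ∫⁻ x, f x ∂(gaussianReal m v) = ∫⁻ x, ENNReal.ofReal (gaussianPDFReal m v x) * f x := by
  rw [gaussianReal_of_var_ne_zero m hv,
    lintegral_withDensity_eq_lintegral_mul _ (measurable_gaussianPDF m v) hf]
  rfl

/-- Cameron-Martin in one dimension. The variance is `s / 2` because a real coordinate carries half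
of the complex variance. At `s = 0` the law is a point mass without density, hence the separate
case. -/
theorem lintegral_gaussianReal_shift (s : ℝ≥0) (x : ℝ) {f : ℝ → ℝ≥0∞} (hf : Measurable f) :
    ∫⁻ w, f (w + s * x) ∂(gaussianReal 0 (s / 2)) =
      ∫⁻ w, ENNReal.ofReal (Real.exp (2 * (x * w) - s * x ^ 2)) * f w
        ∂(gaussianReal 0 (s / 2)) := by
  rcases eq_or_ne s 0 with rfl | hs
  · have : (0 : ℝ≥0) / 2 = 0 := by simp
    rw [this, gaussianReal_zero_var, lintegral_dirac' _ (by fun_prop),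
      lintegral_dirac' _ (by fun_prop)]
    simp
  have hv : s / 2 ≠ 0 := by positivity
  have hs' : (s : ℝ) ≠ 0 := by exact_mod_cast hs
  have h1 : ∫⁻ w, f (w + s * x) ∂(gaussianReal 0 (s / 2)) =
      ∫⁻ w, f w ∂(gaussianReal (s * x) (s / 2)) := by
    have := gaussianReal_map_add_const (μ := 0) (v := s / 2) (s * x)
    rw [zero_add] at this
    rw [← this, lintegral_map hf (by fun_prop)]
  rw [h1, lintegral_gaussianReal hv _ hf, lintegral_gaussianReal hv _ (by fun_prop)]
  refine lintegral_congr fun w => ?_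
  rw [← mul_assoc, ← ENNReal.ofReal_mul (gaussianPDFReal_nonneg _ _ _)]
  congr 2
  simp only [gaussianPDFReal]
  rw [mul_assoc (√(2 * Real.pi * ↑(s / 2)))⁻¹, ← Real.exp_add]
  congr 2
  push_cast
  field_simp
  ring

/-- Completing the square: prior times likelihood is a constant times the posterior density,
Gaussian with mean `(m + v w) / (1 + s v)` and variance `(v / 2) / (1 + s v)`. -/
theorem lintegral_tilt_gaussianReal (m : ℝ) (v : ℝ≥0) {s : ℝ} (hs : 0 ≤ s) (w : ℝ) :
    ∫⁻ x, ENNReal.ofReal (Real.exp (2 * (x * w) - s * x ^ 2)) ∂(gaussianReal m (v / 2)) =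
      ENNReal.ofReal (Real.exp ((v * w ^ 2 + 2 * (w * m) - s * m ^ 2) / (1 + s * v)) /
        Real.sqrt (1 + s * v)) := by
  rcases eq_or_ne v 0 with rfl | hv0
  · have : (0 : ℝ≥0) / 2 = 0 := by simp
    rw [this, gaussianReal_zero_var, lintegral_dirac' _ (by fun_prop)]
    simp [mul_comm]
  have hv : v / 2 ≠ 0 := by positivity
  have hvpos : (0 : ℝ) < v := by exact_mod_cast pos_iff_ne_zero.mpr hv0
  have hk : 0 < 1 + s * v := by positivity
  set k : ℝ≥0 := ⟨1 + s * v, hk.le⟩ with hkdef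
  have hkc : (k : ℝ) = 1 + s * v := rfl
  have hk0 : k ≠ 0 := by
    intro h
    rw [h] at hkc
    simp at hkc
    linarith
  have hv' : v / 2 / k ≠ 0 := by positivity
  rw [lintegral_gaussianReal hv _ (by fun_prop)]
  have key : ∀ x : ℝ, ENNReal.ofReal (gaussianPDFReal m (v / 2) x) *
      ENNReal.ofReal (Real.exp (2 * (x * w) - s * x ^ 2)) =
      ENNReal.ofReal (Real.exp ((v * w ^ 2 + 2 * (w * m) - s * m ^ 2) / (1 + s * v)) /
        Real.sqrt (1 + s * v)) * gaussianPDF ((m + v * w) / (1 + s * v)) (v / 2 / k) x := by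
    intro x
    rw [gaussianPDF_def, ← ENNReal.ofReal_mul (gaussianPDFReal_nonneg _ _ _),
      ← ENNReal.ofReal_mul (by positivity)]
    congr 1
    simp only [gaussianPDFReal]
    push_cast
    rw [hkc]
    have e1 : Real.sqrt (2 * Real.pi * (v / 2 / (1 + s * v))) =
        Real.sqrt (2 * Real.pi * (v / 2)) / Real.sqrt (1 + s * v) := by
      rw [← Real.sqrt_div (by positivity)]
      congr 1
      ring
    rw [e1]
    have e2 : Real.exp (-(x - m) ^ 2 / (2 * (v / 2))) * Real.exp (2 * (x * w) - s * x ^ 2) =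
        Real.exp ((v * w ^ 2 + 2 * (w * m) - s * m ^ 2) / (1 + s * v)) *
        Real.exp (-(x - (m + v * w) / (1 + s * v)) ^ 2 / (2 * (v / 2 / (1 + s * v)))) := by
      rw [← Real.exp_add, ← Real.exp_add]
      congr 1
      field_simp
      ring
    rw [mul_assoc, e2]
    have : 0 < Real.sqrt (1 + s * v) := Real.sqrt_pos.mpr hk
    field_simp
  simp_rw [key]
  rw [lintegral_const_mul _ (measurable_gaussianPDF _ _), lintegral_gaussianPDF_eq_one _ hv',
    mul_one]

theorem lintegral_gaussianReal_add (s t : ℝ≥0) {f : ℝ → ℝ≥0∞} (hf : Measurable f) :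
    ∫⁻ a, ∫⁻ b, f (a + b) ∂(gaussianReal 0 (t / 2)) ∂(gaussianReal 0 (s / 2)) =
      ∫⁻ a, f a ∂(gaussianReal 0 ((s + t) / 2)) := by
  have h := gaussianReal_conv_gaussianReal (m₁ := 0) (m₂ := 0) (v₁ := s / 2) (v₂ := t / 2)
  rw [zero_add, ← add_div] at h
  rw [← h, Measure.lintegral_conv hf]

/-! ### Complex Gaussian measures -/

instance (m : ℂ) (v : ℝ≥0) : IsProbabilityMeasure (complexGaussian m v) := by
  unfold complexGaussian
  refine Measure.isProbabilityMeasure_map ?_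
  exact (Complex.measurableEquivRealProd.symm.measurable).aemeasurable

theorem measurable_complex_mk : Measurable (fun q : ℝ × ℝ => (⟨q.1, q.2⟩ : ℂ)) :=
  Complex.measurableEquivRealProd.symm.measurable

theorem lintegral_complexGaussian (m : ℂ) (v : ℝ≥0) {f : ℂ → ℝ≥0∞} (hf : Measurable f) :
    ∫⁻ z, f z ∂(complexGaussian m v) =
      ∫⁻ x, ∫⁻ y, f ⟨x, y⟩ ∂(gaussianReal m.im (v / 2)) ∂(gaussianReal m.re (v / 2)) := by
  unfold complexGaussian
  rw [lintegral_map hf measurable_complex_mk,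
    lintegral_prod (fun q : ℝ × ℝ => f ⟨q.1, q.2⟩) (hf.comp measurable_complex_mk).aemeasurable]

theorem lintegral_complexGaussian_add (s t : ℝ≥0) {f : ℂ → ℝ≥0∞} (hf : Measurable f) :
    ∫⁻ a, ∫⁻ b, f (a + b) ∂(complexGaussian 0 t) ∂(complexGaussian 0 s) =
      ∫⁻ a, f a ∂(complexGaussian 0 (s + t)) := by
  have hmk := measurable_complex_mk
  have hF : Measurable fun q : (ℝ × ℝ) × ℝ × ℝ =>
      f (⟨q.1.1, q.1.2⟩ + ⟨q.2.1, q.2.2⟩) := by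
    refine hf.comp ((hmk.comp measurable_fst).add (hmk.comp measurable_snd))
  have hin : Measurable fun a => ∫⁻ b, f (a + b) ∂(complexGaussian 0 t) :=
    (show Measurable fun q : ℂ × ℂ => f (q.1 + q.2) by fun_prop).lintegral_prod_right'
  rw [lintegral_complexGaussian _ _ hin, lintegral_complexGaussian _ _ hf]
  simp only [Complex.zero_re, Complex.zero_im]
  have h1 : ∀ x y : ℝ, ∫⁻ b, f (⟨x, y⟩ + b) ∂(complexGaussian 0 t) =
      ∫⁻ x', ∫⁻ y', f ⟨x + x', y + y'⟩ ∂(gaussianReal 0 (t / 2))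
        ∂(gaussianReal 0 (t / 2)) := by
    intro x y
    rw [lintegral_complexGaussian _ _ (by fun_prop)]
    rfl
  simp_rw [h1]
  have h2 : ∀ x : ℝ, ∫⁻ y, ∫⁻ x', ∫⁻ y', f ⟨x + x', y + y'⟩ ∂(gaussianReal 0 (t / 2))
        ∂(gaussianReal 0 (t / 2)) ∂(gaussianReal 0 (s / 2)) =
      ∫⁻ x', ∫⁻ y, f ⟨x + x', y⟩ ∂(gaussianReal 0 ((s + t) / 2))
        ∂(gaussianReal 0 (t / 2)) := by
    intro x
    rw [lintegral_lintegral_swap]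
    · refine lintegral_congr fun x' => ?_
      exact lintegral_gaussianReal_add s t (f := fun y => f ⟨x + x', y⟩)
        (hf.comp (hmk.comp (by fun_prop : Measurable fun y : ℝ => (x + x', y))))
    · refine Measurable.aemeasurable ?_
      refine Measurable.lintegral_prod_right' (f := fun q : (ℝ × ℝ) × ℝ =>
        f ⟨x + q.1.2, q.1.1 + q.2⟩) ?_
      exact hf.comp (hmk.comp
        (by fun_prop : Measurable fun q : (ℝ × ℝ) × ℝ => (x + q.1.2, q.1.1 + q.2)))
  simp_rw [h2]
  refine lintegral_gaussianReal_add s t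
    (f := fun x => ∫⁻ y, f ⟨x, y⟩ ∂(gaussianReal 0 ((s + t) / 2))) ?_
  exact Measurable.lintegral_prod_right' (f := fun q : ℝ × ℝ => f ⟨q.1, q.2⟩) (hf.comp hmk)

theorem lintegral_complexGaussian_scale (s : ℝ≥0) {f : ℂ → ℝ≥0∞} (hf : Measurable f) :
    ∫⁻ a, f ((Real.sqrt s : ℂ) * a) ∂(complexGaussian 0 1) =
      ∫⁻ a, f a ∂(complexGaussian 0 s) := by
  have hmk := measurable_complex_mk
  have hg : ((gaussianReal 0 (1 / 2)).map fun x => Real.sqrt s * x) = gaussianReal 0 (s / 2) := by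
    rw [gaussianReal_map_const_mul, mul_zero]
    congr 1
    ext
    simp [div_eq_mul_inv]
  rw [lintegral_complexGaussian _ _ hf, lintegral_complexGaussian _ _ (by fun_prop)]
  simp only [Complex.zero_re, Complex.zero_im]
  have h1 : ∀ x y : ℝ, (Real.sqrt s : ℂ) * ⟨x, y⟩ = ⟨Real.sqrt s * x, Real.sqrt s * y⟩ := by
    intro x y
    apply Complex.ext <;> simp
  simp_rw [h1]
  rw [← hg]
  have hm : Measurable fun x : ℝ => Real.sqrt s * x := by fun_prop
  rw [lintegral_map (Measurable.lintegral_prod_right' (f := fun q : ℝ × ℝ => f ⟨q.1, q.2⟩)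
    (hf.comp hmk)) hm]
  refine lintegral_congr fun x => ?_
  rw [lintegral_map (f := fun y => f ⟨Real.sqrt s * x, y⟩) (hf.comp (hmk.comp
    (by fun_prop : Measurable fun y : ℝ => (Real.sqrt s * x, y)))) hm]

/-- The likelihood ratio at `w` of the Gaussian law with variance `s` centred at `s x` with respect
to the centred one. -/
def tilt (s : ℝ) (x w : ℂ) : ℝ :=
  Real.exp (2 * (x.re * w.re + x.im * w.im) - s * (x.re ^ 2 + x.im ^ 2))

theorem tilt_pos (s : ℝ) (x w : ℂ) : 0 < tilt s x w := Real.exp_pos _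

theorem measurable_tilt : Measurable fun q : ℝ × ℂ × ℂ => tilt q.1 q.2.1 q.2.2 := by
  unfold tilt
  fun_prop

@[fun_prop]
theorem measurable_tilt_comp {α : Type*} [MeasurableSpace α] {f : α → ℝ} {g h : α → ℂ}
    (hf : Measurable f) (hg : Measurable g) (hh : Measurable h) :
    Measurable fun a => tilt (f a) (g a) (h a) :=
  measurable_tilt.comp (hf.prodMk (hg.prodMk hh))

theorem tilt_eq_mul (s : ℝ) (x w : ℂ) :
    tilt s x w = Real.exp (2 * (x.re * w.re) - s * x.re ^ 2) *
      Real.exp (2 * (x.im * w.im) - s * x.im ^ 2) := by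
  rw [← Real.exp_add, tilt]
  congr 1
  ring

theorem tilt_add (s t : ℝ) (x w w' : ℂ) : tilt (s + t) x (w + w') = tilt s x w * tilt t x w' := by
  rw [tilt, tilt, tilt, ← Real.exp_add]
  congr 1
  simp
  ring

theorem lintegral_complexGaussian_shift (s : ℝ≥0) (x : ℂ) {f : ℂ → ℝ≥0∞} (hf : Measurable f) :
    ∫⁻ w, f (w + s * x) ∂(complexGaussian 0 s) =
      ∫⁻ w, ENNReal.ofReal (tilt s x w) * f w ∂(complexGaussian 0 s) := by
  have hmk := measurable_complex_mk
  rw [lintegral_complexGaussian _ _ (by fun_prop), lintegral_complexGaussian _ _ (by fun_prop)]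
  simp only [Complex.zero_re, Complex.zero_im]
  have h1 : ∀ a b : ℝ, (⟨a, b⟩ : ℂ) + s * x = ⟨a + s * x.re, b + s * x.im⟩ := by
    intro a b
    apply Complex.ext <;> simp
  simp_rw [h1]
  have hm : ∀ a : ℝ, Measurable fun b : ℝ => f ⟨a, b⟩ := fun a =>
    hf.comp (hmk.comp (by fun_prop : Measurable fun y : ℝ => (a, y)))
  have h2 : ∀ a : ℝ, ∫⁻ b, f ⟨a, b + s * x.im⟩ ∂(gaussianReal 0 (s / 2)) =
      ∫⁻ b, ENNReal.ofReal (Real.exp (2 * (x.im * b) - s * x.im ^ 2)) * f ⟨a, b⟩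
        ∂(gaussianReal 0 (s / 2)) := fun a =>
    lintegral_gaussianReal_shift s x.im (f := fun b => f ⟨a, b⟩) (hm a)
  simp_rw [h2]
  have hF : Measurable fun a : ℝ =>
      ∫⁻ b, ENNReal.ofReal (Real.exp (2 * (x.im * b) - s * x.im ^ 2)) * f ⟨a, b⟩
        ∂(gaussianReal 0 (s / 2)) :=
    Measurable.lintegral_prod_right' (f := fun q : ℝ × ℝ =>
      ENNReal.ofReal (Real.exp (2 * (x.im * q.2) - s * x.im ^ 2)) * f ⟨q.1, q.2⟩)
      ((by fun_prop : Measurable fun q : ℝ × ℝ =>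
        ENNReal.ofReal (Real.exp (2 * (x.im * q.2) - s * x.im ^ 2))).mul (hf.comp hmk))
  rw [lintegral_gaussianReal_shift s x.re (f := fun a =>
    ∫⁻ b, ENNReal.ofReal (Real.exp (2 * (x.im * b) - s * x.im ^ 2)) * f ⟨a, b⟩
        ∂(gaussianReal 0 (s / 2))) hF]
  refine lintegral_congr fun a => ?_
  rw [← lintegral_const_mul _ (by have := hm a; fun_prop)]
  refine lintegral_congr fun b => ?_
  rw [← mul_assoc, ← ENNReal.ofReal_mul (Real.exp_pos _).le, tilt_eq_mul]

theorem lintegral_tilt_right (s : ℝ≥0) (x : ℂ) :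
    ∫⁻ w, ENNReal.ofReal (tilt s x w) ∂(complexGaussian 0 s) = 1 := by
  have := lintegral_complexGaussian_shift s x (f := fun _ => 1) measurable_const
  simpa using this.symm

/-- The mean of `x ↦ tilt s x w` under the complex Gaussian law. -/
def gaussianTilt (m : ℂ) (v : ℝ≥0) (s : ℝ) (w : ℂ) : ℝ :=
  Real.exp ((v * (w.re ^ 2 + w.im ^ 2) + 2 * (w.re * m.re + w.im * m.im) -
    s * (m.re ^ 2 + m.im ^ 2)) / (1 + s * v)) / (1 + s * v)

theorem lintegral_tilt_left (m : ℂ) (v : ℝ≥0) {s : ℝ} (hs : 0 ≤ s) (w : ℂ) :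
    ∫⁻ x, ENNReal.ofReal (tilt s x w) ∂(complexGaussian m v) =
      ENNReal.ofReal (gaussianTilt m v s w) := by
  rw [lintegral_complexGaussian _ _ (by fun_prop)]
  simp only [tilt_eq_mul]
  have hk : 0 ≤ 1 + s * v := by positivity
  have h1 : ∀ a : ℝ, ∫⁻ b, ENNReal.ofReal (Real.exp (2 * (a * w.re) - s * a ^ 2) *
      Real.exp (2 * (b * w.im) - s * b ^ 2)) ∂(gaussianReal m.im (v / 2)) =
      ENNReal.ofReal (Real.exp (2 * (a * w.re) - s * a ^ 2)) *
      ENNReal.ofReal (Real.exp ((v * w.im ^ 2 + 2 * (w.im * m.im) - s * m.im ^ 2) / (1 + s * v)) /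
        Real.sqrt (1 + s * v)) := by
    intro a
    rw [← lintegral_tilt_gaussianReal m.im v hs w.im, ← lintegral_const_mul _ (by fun_prop)]
    refine lintegral_congr fun b => ?_
    rw [ENNReal.ofReal_mul (Real.exp_pos _).le]
  simp_rw [h1]
  rw [lintegral_mul_const _ (by fun_prop), lintegral_tilt_gaussianReal m.re v hs w.re,
    ← ENNReal.ofReal_mul (by positivity)]
  congr 1
  rw [div_mul_div_comm, Real.mul_self_sqrt hk, ← Real.exp_add, gaussianTilt, ← add_div]
  congr 3
  ring

/-! ### Moments -/

theorem integrable_norm_sq_complexGaussian (m : ℂ) (v : ℝ≥0) :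
    Integrable (fun z : ℂ => ‖z‖ ^ 2) (complexGaussian m v) := by
  have hs : ∀ a : ℝ, Integrable (fun x : ℝ => x ^ 2) (gaussianReal a (v / 2)) := fun a =>
    (memLp_id_gaussianReal (μ := a) (v := v / 2) 2).integrable_sq
  unfold complexGaussian
  rw [integrable_map_measure (by fun_prop) measurable_complex_mk.aemeasurable]
  have : ((fun z : ℂ => ‖z‖ ^ 2) ∘ fun q : ℝ × ℝ => (⟨q.1, q.2⟩ : ℂ)) =
      fun q => q.1 ^ 2 + q.2 ^ 2 := by
    funext q
    rw [Function.comp_apply, Complex.sq_norm, Complex.normSq_apply, pow_two, pow_two]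
  rw [this]
  exact ((hs m.re).comp_fst _).add ((hs m.im).comp_snd _)

/-- The centred law is invariant under `z ↦ -z`. -/
theorem integral_id_complexGaussian (v : ℝ≥0) : ∫ z, z ∂(complexGaussian 0 v) = 0 := by
  have h1 : (complexGaussian 0 v).map (fun z => -z) = complexGaussian 0 v := by
    refine Measure.ext_of_lintegral _ fun f hf => ?_
    have hg : (gaussianReal 0 (v / 2)).map (fun x => -x) = gaussianReal 0 (v / 2) := by
      rw [gaussianReal_map_neg, neg_zero]
    have hmk := measurable_complex_mk
    have hm : Measurable fun x : ℝ => -x := by fun_prop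
    rw [lintegral_map hf (by fun_prop), lintegral_complexGaussian _ _ hf,
      lintegral_complexGaussian _ _ (by fun_prop)]
    simp only [Complex.zero_re, Complex.zero_im]
    conv_rhs => rw [← hg]
    rw [lintegral_map (Measurable.lintegral_prod_right' (f := fun q : ℝ × ℝ => f ⟨q.1, q.2⟩)
      (hf.comp hmk)) hm]
    refine lintegral_congr fun x => ?_
    rw [lintegral_map (f := fun y => f ⟨-x, y⟩) (hf.comp (hmk.comp
      (by fun_prop : Measurable fun y : ℝ => (-x, y)))) hm]
    rfl
  have h2 : ∫ z, z ∂(complexGaussian 0 v) = -∫ z, z ∂(complexGaussian 0 v) := by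
    conv_lhs => rw [← h1]
    rw [integral_map (by fun_prop) (by fun_prop), integral_neg]
  have h3 := self_eq_neg.mp h2
  exact h3

/-- Full support upgrades almost everywhere equality of continuous functions to equality everywhere
in the equality case of `outputDiv_add_lt`. -/
instance (s : ℝ≥0) [NeZero s] : (complexGaussian 0 s).IsOpenPosMeasure := by
  have hv : s / 2 ≠ 0 := by
    have := NeZero.ne s
    positivity
  have : (gaussianReal 0 (s / 2)).IsOpenPosMeasure :=
    (gaussianReal_absolutelyContinuous' 0 hv).isOpenPosMeasure
  unfold complexGaussian
  exact (Complex.equivRealProdCLM.symm.continuous).isOpenPosMeasure_map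
    Complex.equivRealProdCLM.symm.surjective

/-! ### Likelihood ratio averaged over a prior -/

/-- The likelihood ratio `w ↦ tilt s x w` averaged over the law `P` of `x`. -/
def avgTilt (P : Measure ℂ) (s : ℝ) (w : ℂ) : ℝ := ∫ x, tilt s x w ∂P

/-- The exponent is `‖y‖² - ‖y - x‖²`. Uniformity in `x` makes the likelihood ratio integrable under
every prior. -/
theorem tilt_one_le (x y : ℂ) : tilt 1 x y ≤ Real.exp (‖y‖ ^ 2) := by
  rw [tilt, Complex.sq_norm, Complex.normSq_apply]
  apply Real.exp_le_exp.mpr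
  nlinarith [sq_nonneg (y.re - x.re), sq_nonneg (y.im - x.im)]

/-- Dictionary between the two normalizations: signal `√s x` in unit noise, and signal `s x` in
noise of variance `s`. -/
theorem tilt_sqrt_mul {s : ℝ} (hs : 0 ≤ s) (x y : ℂ) :
    tilt s x ((Real.sqrt s : ℂ) * y) = tilt 1 ((Real.sqrt s : ℂ) * x) y := by
  have h := Real.mul_self_sqrt hs
  simp only [tilt]
  congr 1
  simp
  linear_combination (x.re ^ 2 + x.im ^ 2) * h

theorem exists_sqrt_mul {s : ℝ} (hs : 0 < s) (w : ℂ) : ∃ y : ℂ, w = (Real.sqrt s : ℂ) * y := by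
  have : (Real.sqrt s : ℂ) ≠ 0 := by
    exact_mod_cast (Real.sqrt_pos.mpr hs).ne'
  exact ⟨w / Real.sqrt s, by field_simp⟩

/-- The divergence from the noise law of the law of the channel output, as a function of the
signal-to-noise ratio. -/
def outputDiv (P : Measure ℂ) (s : ℝ) : ℝ :=
  ∫ q, Real.log (avgTilt P s (s * q.1 + Real.sqrt s * q.2)) ∂(P.prod (complexGaussian 0 1))

theorem channelLaw_eq_withDensity (P : Measure ℂ) {s : ℝ} (hs : 0 ≤ s) :
    channelLaw P s = (P.prod (complexGaussian 0 1)).withDensity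
      (fun q => ENNReal.ofReal (tilt s q.1 ((Real.sqrt s : ℂ) * q.2))) := by
  refine Measure.ext_of_lintegral _ fun f hf => ?_
  rw [channelLaw, lintegral_map hf (by fun_prop), lintegral_prod _ (by fun_prop),
    lintegral_withDensity_eq_lintegral_mul _ (by fun_prop) hf, lintegral_prod _ (by fun_prop)]
  refine lintegral_congr fun x => ?_
  have h := lintegral_complexGaussian_shift 1 ((Real.sqrt s : ℂ) * x)
    (f := fun w => f (x, w)) (by fun_prop)
  simp only [NNReal.coe_one, Complex.ofReal_one, one_mul] at h
  simp only [add_comm ((Real.sqrt s : ℂ) * x), Pi.mul_apply, tilt_sqrt_mul hs]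
  exact h

theorem fst_channelLaw (P : Measure ℂ) (s : ℝ) : (channelLaw P s).fst = P := by
  rw [channelLaw, Measure.fst, Measure.map_map measurable_fst (by fun_prop)]
  exact Measure.fst_prod

section

variable {P : Measure ℂ} [IsProbabilityMeasure P]

theorem integrable_tilt_sqrt_mul {s : ℝ} (hs : 0 ≤ s) (y : ℂ) :
    Integrable (fun x => tilt s x ((Real.sqrt s : ℂ) * y)) P := by
  refine Integrable.of_bound (C := Real.exp (‖y‖ ^ 2)) (by fun_prop) (ae_of_all _ fun x => ?_)
  rw [tilt_sqrt_mul hs, Real.norm_of_nonneg (tilt_pos _ _ _).le]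
  exact tilt_one_le _ _

/-- For `s = 0` the integrand is `exp(2 Re(x̄ w))`, which a general prior need not integrate. -/
theorem integrable_tilt {s : ℝ} (hs : 0 < s) (w : ℂ) : Integrable (fun x => tilt s x w) P := by
  obtain ⟨y, rfl⟩ := exists_sqrt_mul hs w
  exact integrable_tilt_sqrt_mul hs.le y

theorem avgTilt_sqrt_mul_le {s : ℝ} (hs : 0 ≤ s) (y : ℂ) :
    avgTilt P s ((Real.sqrt s : ℂ) * y) ≤ Real.exp (‖y‖ ^ 2) := by
  have : ∫ _, Real.exp (‖y‖ ^ 2) ∂P = Real.exp (‖y‖ ^ 2) := by simp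
  rw [avgTilt, ← this]
  refine integral_mono (integrable_tilt_sqrt_mul hs y) (integrable_const _) fun x => ?_
  simp only [tilt_sqrt_mul hs]
  exact tilt_one_le _ _

theorem ofReal_avgTilt_sqrt_mul {s : ℝ} (hs : 0 ≤ s) (y : ℂ) :
    ENNReal.ofReal (avgTilt P s ((Real.sqrt s : ℂ) * y)) =
      ∫⁻ x, ENNReal.ofReal (tilt s x ((Real.sqrt s : ℂ) * y)) ∂P :=
  ofReal_integral_eq_lintegral_ofReal (integrable_tilt_sqrt_mul hs y)
    (ae_of_all _ fun _ => (tilt_pos _ _ _).le)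

theorem ofReal_avgTilt {s : ℝ} (hs : 0 < s) (w : ℂ) :
    ENNReal.ofReal (avgTilt P s w) = ∫⁻ x, ENNReal.ofReal (tilt s x w) ∂P :=
  ofReal_integral_eq_lintegral_ofReal (integrable_tilt hs w)
    (ae_of_all _ fun _ => (tilt_pos _ _ _).le)

@[fun_prop]
theorem measurable_avgTilt (s : ℝ) : Measurable (avgTilt P s) := by
  have : StronglyMeasurable fun q : ℂ × ℂ => tilt s q.2 q.1 :=
    (by fun_prop : Measurable fun q : ℂ × ℂ => tilt s q.2 q.1).stronglyMeasurable
  exact this.integral_prod_right.measurable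

instance (s : ℝ) : IsProbabilityMeasure (channelLaw P s) :=
  Measure.isProbabilityMeasure_map (by fun_prop)

theorem snd_channelLaw {s : ℝ} (hs : 0 ≤ s) :
    (channelLaw P s).snd = (complexGaussian 0 1).withDensity
      (fun y => ENNReal.ofReal (avgTilt P s ((Real.sqrt s : ℂ) * y))) := by
  refine Measure.ext_of_lintegral _ fun f hf => ?_
  rw [Measure.snd, lintegral_map hf measurable_snd, channelLaw_eq_withDensity _ hs,
    lintegral_withDensity_eq_lintegral_mul _ (by fun_prop) (by fun_prop),
    lintegral_withDensity_eq_lintegral_mul _ (by fun_prop) hf, lintegral_prod_symm _ (by fun_prop)]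
  refine lintegral_congr fun y => ?_
  simp only [Pi.mul_apply]
  rw [lintegral_mul_const _ (by fun_prop), ofReal_avgTilt_sqrt_mul hs]

/-- The divergence of two laws with positive densities with respect to the same measure. -/
theorem klDiv_withDensity_ofReal {α : Type*} [MeasurableSpace α] {μ ν κ : Measure α}
    [SigmaFinite κ] [IsProbabilityMeasure μ] [IsProbabilityMeasure ν] {f g : α → ℝ}
    (hf : Measurable f) (hg : Measurable g) (hfpos : ∀ a, 0 < f a) (hgpos : ∀ a, 0 < g a)
    (hμ : μ = κ.withDensity fun a => ENNReal.ofReal (f a))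
    (hν : ν = κ.withDensity fun a => ENNReal.ofReal (g a))
    (hint : Integrable (fun a => Real.log (f a) - Real.log (g a)) μ) :
    InformationTheory.klDiv μ ν ≠ ⊤ ∧
      (InformationTheory.klDiv μ ν).toReal = ∫ a, Real.log (f a) - Real.log (g a) ∂μ := by
  have h1 : μ = ν.withDensity fun a => ENNReal.ofReal (f a / g a) := by
    rw [hν, ← withDensity_mul _ (by fun_prop) (by fun_prop), hμ]
    congr 1
    funext a
    rw [Pi.mul_apply, ← ENNReal.ofReal_mul (hgpos a).le, mul_div_cancel₀ _ (hgpos a).ne']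
  have hac : μ ≪ ν := h1 ▸ withDensity_absolutelyContinuous _ _
  have hllr : llr μ ν =ᵐ[μ] fun a => Real.log (f a) - Real.log (g a) := by
    refine hac.ae_le ?_
    have h2 := ν.rnDeriv_withDensity (f := fun a => ENNReal.ofReal (f a / g a)) (by fun_prop)
    rw [← h1] at h2
    filter_upwards [h2] with a ha
    rw [llr, ha, ENNReal.toReal_ofReal (div_pos (hfpos a) (hgpos a)).le,
      Real.log_div (hfpos a).ne' (hgpos a).ne']
  refine ⟨InformationTheory.klDiv_ne_top hac (hint.congr hllr.symm), ?_⟩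
  rw [InformationTheory.toReal_klDiv_of_measure_eq hac (by simp), integral_congr_ae hllr]

theorem abs_log_le {c M a : ℝ} (hc : 0 < c) (h1 : c ≤ a) (h2 : a ≤ Real.exp M) (hM : 0 ≤ M) :
    |Real.log a| ≤ |Real.log c| + M := by
  have h3 : Real.log a ≤ M := by
    rw [Real.log_le_iff_le_exp (hc.trans_le h1)]
    exact h2
  have h4 := Real.log_le_log hc h1
  rw [abs_le]
  constructor
  · linarith [neg_abs_le (Real.log c)]
  · linarith [abs_nonneg (Real.log c)]

theorem output_eq_sqrt_mul {s : ℝ} (hs : 0 ≤ s) (x z : ℂ) :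
    (s : ℂ) * x + Real.sqrt s * z = Real.sqrt s * (Real.sqrt s * x + z) := by
  have h : (Real.sqrt s : ℂ) * Real.sqrt s = s := by exact_mod_cast Real.mul_self_sqrt hs
  rw [← h]
  ring

/-- The logarithm lies between `log c` and the squared norm of the unit-noise output, which is
integrable by the second moment. -/
theorem integrable_log_avgTilt {c s : ℝ} (hs : 0 ≤ s) (hm : Integrable (fun x => ‖x‖ ^ 2) P)
    (hc : 0 < c) (hlow : ∀ w, c ≤ avgTilt P s w) :
    Integrable (fun q : ℂ × ℂ => Real.log (avgTilt P s (s * q.1 + Real.sqrt s * q.2)))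
      (P.prod (complexGaussian 0 1)) := by
  have hb : Integrable (fun q : ℂ × ℂ => |Real.log c| + (2 * s * ‖q.1‖ ^ 2 + 2 * ‖q.2‖ ^ 2))
      (P.prod (complexGaussian 0 1)) :=
    (integrable_const _).add (((hm.comp_fst _).const_mul _).add
      (((integrable_norm_sq_complexGaussian 0 1).comp_snd _).const_mul _))
  refine hb.mono' (by fun_prop : Measurable _).aestronglyMeasurable (ae_of_all _ fun q => ?_)
  rw [output_eq_sqrt_mul hs, Real.norm_eq_abs]
  refine (abs_log_le hc (hlow _) (avgTilt_sqrt_mul_le hs _) (by positivity)).trans ?_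
  gcongr
  have h1 := norm_add_le ((Real.sqrt s : ℂ) * q.1) q.2
  rw [norm_mul, Complex.norm_real, Real.norm_of_nonneg (Real.sqrt_nonneg s)] at h1
  have h2 : (Real.sqrt s * ‖q.1‖) ^ 2 = s * ‖q.1‖ ^ 2 := by rw [mul_pow, Real.sq_sqrt hs]
  have h3 := pow_le_pow_left₀ (norm_nonneg _) h1 2
  nlinarith [sq_nonneg (Real.sqrt s * ‖q.1‖ - ‖q.2‖)]

theorem integrable_id_of_norm_sq (hm : Integrable (fun x => ‖x‖ ^ 2) P) :
    Integrable (fun x : ℂ => x) P := by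
  have : MemLp (fun x : ℂ => x) 2 P :=
    (memLp_two_iff_integrable_sq_norm (by fun_prop)).mpr hm
  exact this.integrable (by norm_num)

theorem integrable_inner (hm : Integrable (fun x => ‖x‖ ^ 2) P) :
    Integrable (fun q : ℂ × ℂ => q.1.re * q.2.re + q.1.im * q.2.im)
      (P.prod (complexGaussian 0 1)) := by
  have h := integrable_id_of_norm_sq hm
  have h' := integrable_id_of_norm_sq (integrable_norm_sq_complexGaussian 0 1)
  exact (h.re.mul_prod h'.re).add (h.im.mul_prod h'.im)

theorem integral_inner (hm : Integrable (fun x => ‖x‖ ^ 2) P) :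
    ∫ q : ℂ × ℂ, q.1.re * q.2.re + q.1.im * q.2.im ∂(P.prod (complexGaussian 0 1)) = 0 := by
  have h := integrable_id_of_norm_sq hm
  have h' := integrable_id_of_norm_sq (integrable_norm_sq_complexGaussian 0 1)
  have h0 := integral_id_complexGaussian 1
  have hre : ∫ z : ℂ, z.re ∂(complexGaussian 0 1) = 0 := by
    have := integral_re h'
    rw [h0] at this
    simpa using this
  have him : ∫ z : ℂ, z.im ∂(complexGaussian 0 1) = 0 := by
    have := integral_im h'
    rw [h0] at this
    simpa using this
  refine (integral_add (h.re.mul_prod h'.re) (h.im.mul_prod h'.im)).trans ?_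
  simp only [RCLike.re_to_complex, RCLike.im_to_complex]
  rw [integral_prod_mul (fun x : ℂ => x.re) (fun x : ℂ => x.re),
    integral_prod_mul (fun x : ℂ => x.im) (fun x : ℂ => x.im), hre, him]
  simp

/-- With respect to `P ⊗ CN(0, 1)` the joint law has density `tilt` and the product of marginals has
density `avgTilt`. The mean of `log tilt` is `s E|X|²`, as the cross term is centred. -/
theorem mutualInfo_channelLaw {c s : ℝ} (hs : 0 ≤ s) (hm : Integrable (fun x => ‖x‖ ^ 2) P)
    (hc : 0 < c) (hlow : ∀ w, c ≤ avgTilt P s w) :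
    mutualInfo (channelLaw P s) ≠ ⊤ ∧
      (mutualInfo (channelLaw P s)).toReal = s * ∫ x, ‖x‖ ^ 2 ∂P - outputDiv P s := by
  have hprod : (channelLaw P s).fst.prod (channelLaw P s).snd =
      (P.prod (complexGaussian 0 1)).withDensity
        (fun q => ENNReal.ofReal (avgTilt P s ((Real.sqrt s : ℂ) * q.2))) := by
    have : SFinite ((complexGaussian 0 1).withDensity
        (fun y => ENNReal.ofReal (avgTilt P s ((Real.sqrt s : ℂ) * y)))) := inferInstance
    rw [fst_channelLaw, snd_channelLaw hs, prod_withDensity_right (by fun_prop)]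
  have hexp : ∀ q : ℂ × ℂ,
      Real.log (tilt s q.1 ((Real.sqrt s : ℂ) * (Real.sqrt s * q.1 + q.2))) =
        s * ‖q.1‖ ^ 2 + 2 * Real.sqrt s * (q.1.re * q.2.re + q.1.im * q.2.im) := by
    intro q
    have h := Real.mul_self_sqrt hs
    rw [tilt, Real.log_exp, Complex.sq_norm, Complex.normSq_apply]
    simp
    linear_combination 2 * (q.1.re ^ 2 + q.1.im ^ 2) * h
  have hI1 : Integrable (fun q : ℂ × ℂ => s * ‖q.1‖ ^ 2) (P.prod (complexGaussian 0 1)) :=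
    (hm.comp_fst _).const_mul _
  have hI2 := (integrable_inner hm).const_mul (2 * Real.sqrt s)
  have hI3 := integrable_log_avgTilt hs hm hc hlow
  have hrw : ∀ q : ℂ × ℂ,
      Real.log (tilt s q.1 ((Real.sqrt s : ℂ) * (Real.sqrt s * q.1 + q.2))) -
        Real.log (avgTilt P s ((Real.sqrt s : ℂ) * (Real.sqrt s * q.1 + q.2))) =
      s * ‖q.1‖ ^ 2 + 2 * Real.sqrt s * (q.1.re * q.2.re + q.1.im * q.2.im) -
        Real.log (avgTilt P s (s * q.1 + Real.sqrt s * q.2)) := by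
    intro q
    rw [hexp, output_eq_sqrt_mul hs]
  have hmeas : Measurable fun q : ℂ × ℂ => Real.log (tilt s q.1 ((Real.sqrt s : ℂ) * q.2)) -
        Real.log (avgTilt P s ((Real.sqrt s : ℂ) * q.2)) := by fun_prop
  have hφ : Measurable fun q : ℂ × ℂ => (q.1, (Real.sqrt s : ℂ) * q.1 + q.2) := by fun_prop
  have hint : Integrable (fun q : ℂ × ℂ => Real.log (tilt s q.1 ((Real.sqrt s : ℂ) * q.2)) -
        Real.log (avgTilt P s ((Real.sqrt s : ℂ) * q.2))) (channelLaw P s) := by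
    rw [channelLaw, integrable_map_measure hmeas.aestronglyMeasurable hφ.aemeasurable]
    refine ((hI1.add hI2).sub hI3).congr (ae_of_all _ fun q => ?_)
    exact (hrw q).symm
  have : IsProbabilityMeasure (channelLaw P s).snd :=
    Measure.isProbabilityMeasure_map (by fun_prop)
  have : IsProbabilityMeasure (channelLaw P s).fst :=
    Measure.isProbabilityMeasure_map (by fun_prop)
  obtain ⟨h1, h2⟩ := klDiv_withDensity_ofReal (μ := channelLaw P s)
    (ν := (channelLaw P s).fst.prod (channelLaw P s).snd)
    (κ := P.prod (complexGaussian 0 1))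
    (f := fun q => tilt s q.1 ((Real.sqrt s : ℂ) * q.2))
    (g := fun q => avgTilt P s ((Real.sqrt s : ℂ) * q.2)) (by fun_prop) (by fun_prop)
    (fun _ => tilt_pos _ _ _) (fun _ => hc.trans_le (hlow _))
    (channelLaw_eq_withDensity _ hs) hprod hint
  refine ⟨h1, ?_⟩
  rw [mutualInfo, h2, channelLaw, integral_map hφ.aemeasurable hmeas.aestronglyMeasurable]
  simp only [hrw]
  refine (integral_sub (hI1.add hI2) hI3).trans ?_
  rw [integral_add' hI1 hI2, integral_const_mul,
    integral_const_mul, integral_inner hm, outputDiv,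
    integral_fun_fst (f := fun x : ℂ => ‖x‖ ^ 2)]
  simp

end

/-! ### The output law in additive time -/

/-- The law of `s X + N`, where `X` has law `P` and `N ∼ CN(0, s)` is independent of `X`. -/
def outputLaw (P : Measure ℂ) (s : ℝ≥0) : Measure ℂ :=
  (complexGaussian 0 s).withDensity fun w => ENNReal.ofReal (avgTilt P s w)

/-- Regularity of a prior: finite second moment, averaged likelihood ratios that are continuous,
bounded away from zero and not log-affine. -/
structure IsRegularPrior (P : Measure ℂ) (c : ℝ) : Prop where
  prob : IsProbabilityMeasure P
  moment : Integrable (fun x => ‖x‖ ^ 2) P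
  pos : 0 < c
  le : ∀ s : ℝ, 0 ≤ s → ∀ w, c ≤ avgTilt P s w
  cont : ∀ s : ℝ, 0 ≤ s → Continuous (avgTilt P s)
  ne : ∀ s : ℝ, 0 ≤ s → ∃ w, avgTilt P s w * avgTilt P s (-w) ≠ avgTilt P s 0 ^ 2

section

variable {P : Measure ℂ} [IsProbabilityMeasure P]

theorem lintegral_outputLaw (s : ℝ≥0) {f : ℂ → ℝ≥0∞} (hf : Measurable f) :
    ∫⁻ w, f w ∂(outputLaw P s) =
      ∫⁻ w, ENNReal.ofReal (avgTilt P s w) * f w ∂(complexGaussian 0 s) := by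
  rw [outputLaw, lintegral_withDensity_eq_lintegral_mul _ (by fun_prop) hf]
  rfl

theorem map_eq_outputLaw {s : ℝ≥0} (hs : 0 < s) :
    (P.prod (complexGaussian 0 1)).map (fun q => (s : ℂ) * q.1 + Real.sqrt s * q.2) =
      outputLaw P s := by
  refine Measure.ext_of_lintegral _ fun f hf => ?_
  rw [lintegral_map hf (by fun_prop), lintegral_prod _ (by fun_prop), lintegral_outputLaw _ hf]
  have h1 : ∀ x : ℂ, ∫⁻ z, f ((s : ℂ) * x + Real.sqrt s * z) ∂(complexGaussian 0 1) =
      ∫⁻ w, ENNReal.ofReal (tilt s x w) * f w ∂(complexGaussian 0 s) := by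
    intro x
    rw [lintegral_complexGaussian_scale s (f := fun w => f (s * x + w)) (by fun_prop),
      ← lintegral_complexGaussian_shift s x hf]
    simp only [add_comm]
  refine (lintegral_congr h1).trans ?_
  rw [lintegral_lintegral_swap (by fun_prop)]
  refine lintegral_congr fun w => ?_
  rw [lintegral_mul_const _ (by fun_prop), ofReal_avgTilt (by exact_mod_cast hs)]

theorem isProbabilityMeasure_outputLaw {s : ℝ≥0} (hs : 0 < s) :
    IsProbabilityMeasure (outputLaw P s) := by
  rw [← map_eq_outputLaw hs]
  exact Measure.isProbabilityMeasure_map (by fun_prop)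

theorem lintegral_avgTilt {s : ℝ≥0} (hs : 0 < s) :
    ∫⁻ w, ENNReal.ofReal (avgTilt P s w) ∂(complexGaussian 0 s) = 1 := by
  have := isProbabilityMeasure_outputLaw (P := P) hs
  have h := lintegral_outputLaw (P := P) s (f := fun _ => 1) measurable_const
  simpa using h.symm

theorem outputDiv_eq {s : ℝ≥0} (hs : 0 < s) :
    outputDiv P s = ∫ w, Real.log (avgTilt P s w) ∂(outputLaw P s) := by
  rw [← map_eq_outputLaw hs, integral_map (by fun_prop)
    (by fun_prop : Measurable _).aestronglyMeasurable, outputDiv]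

/-- Martingale property of the likelihood ratio along Brownian motion: `tilt` is multiplicative over
increments and each factor has mean one. -/
theorem lintegral_avgTilt_add {s t : ℝ≥0} (hs : 0 < s) (a : ℂ) :
    ∫⁻ b, ENNReal.ofReal (avgTilt P (s + t : ℝ≥0) (a + b)) ∂(complexGaussian 0 t) =
      ENNReal.ofReal (avgTilt P s a) := by
  have hst : (0 : ℝ) < (s + t : ℝ≥0) := by
    have : (0 : ℝ) < s := by exact_mod_cast hs
    push_cast
    positivity
  simp_rw [ofReal_avgTilt hst]
  rw [lintegral_lintegral_swap (by fun_prop), ofReal_avgTilt (by exact_mod_cast hs)]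
  refine lintegral_congr fun x => ?_
  have : ∀ b, ENNReal.ofReal (tilt (s + t : ℝ≥0) x (a + b)) =
      ENNReal.ofReal (tilt s x a) * ENNReal.ofReal (tilt t x b) := by
    intro b
    rw [NNReal.coe_add, tilt_add, ENNReal.ofReal_mul (tilt_pos _ _ _).le]
  simp_rw [this]
  rw [lintegral_const_mul _ (by fun_prop), lintegral_tilt_right, mul_one]

/-- The joint law of three consecutive increments of `t ↦ t X + W t`, with `W` a complex Brownian
motion independent of `X`. -/
def incrementLaw (P : Measure ℂ) (s t r : ℝ≥0) : Measure (ℂ × ℂ × ℂ) :=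
  ((complexGaussian 0 s).prod ((complexGaussian 0 t).prod (complexGaussian 0 r))).withDensity
    fun q => ENNReal.ofReal (avgTilt P (s + t + r : ℝ≥0) (q.1 + q.2.1 + q.2.2))

theorem lintegral_incrementLaw (s t r : ℝ≥0) {f : ℂ × ℂ × ℂ → ℝ≥0∞} (hf : Measurable f) :
    ∫⁻ q, f q ∂(incrementLaw P s t r) =
      ∫⁻ a, ∫⁻ b, ∫⁻ c, ENNReal.ofReal (avgTilt P (s + t + r : ℝ≥0) (a + b + c)) * f (a, b, c)
        ∂(complexGaussian 0 r) ∂(complexGaussian 0 t) ∂(complexGaussian 0 s) := by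
  rw [incrementLaw, lintegral_withDensity_eq_lintegral_mul _ (by fun_prop) hf,
    lintegral_prod _ (by fun_prop)]
  refine lintegral_congr fun a => ?_
  rw [lintegral_prod _ (by fun_prop)]
  rfl

theorem map_sum_incrementLaw (s t r : ℝ≥0) :
    (incrementLaw P s t r).map (fun q => q.1 + q.2.1 + q.2.2) = outputLaw P (s + t + r) := by
  refine Measure.ext_of_lintegral _ fun f hf => ?_
  rw [lintegral_map hf (by fun_prop), lintegral_incrementLaw _ _ _ (by fun_prop),
    lintegral_outputLaw _ hf]
  have hF : Measurable fun w => ENNReal.ofReal (avgTilt P (s + t + r : ℝ≥0) w) * f w := by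
    fun_prop
  rw [← lintegral_complexGaussian_add (s + t) r hF]
  rw [← lintegral_complexGaussian_add s t (Measurable.lintegral_prod_right' (f := fun q : ℂ × ℂ =>
    ENNReal.ofReal (avgTilt P (s + t + r : ℝ≥0) (q.1 + q.2)) * f (q.1 + q.2)) (by fun_prop))]

theorem map_add_incrementLaw {s : ℝ≥0} (hs : 0 < s) (t r : ℝ≥0) :
    (incrementLaw P s t r).map (fun q => q.1 + q.2.1) = outputLaw P (s + t) := by
  refine Measure.ext_of_lintegral _ fun f hf => ?_
  rw [lintegral_map hf (by fun_prop), lintegral_incrementLaw _ _ _ (by fun_prop),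
    lintegral_outputLaw _ hf, ← lintegral_complexGaussian_add s t (by fun_prop)]
  refine lintegral_congr fun a => lintegral_congr fun b => ?_
  dsimp only
  rw [lintegral_mul_const _ (by fun_prop), lintegral_avgTilt_add (by positivity)]

/-- The density sees only the sum of the increments, so they may be exchanged together with their
durations. -/
theorem map_swap_incrementLaw (s t r : ℝ≥0) :
    (incrementLaw P s t r).map (fun q => (q.1, q.2.2, q.2.1)) = incrementLaw P s r t := by
  refine Measure.ext_of_lintegral _ fun f hf => ?_
  rw [lintegral_map hf (by fun_prop), lintegral_incrementLaw _ _ _ (by fun_prop),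
    lintegral_incrementLaw _ _ _ hf]
  refine lintegral_congr fun a => ?_
  rw [lintegral_lintegral_swap (by fun_prop)]
  simp only [add_right_comm]

theorem map_add_incrementLaw' {s : ℝ≥0} (hs : 0 < s) (t r : ℝ≥0) :
    (incrementLaw P s t r).map (fun q => q.1 + q.2.2) = outputLaw P (s + r) := by
  rw [← map_add_incrementLaw hs r t, ← map_swap_incrementLaw s t r,
    Measure.map_map (by fun_prop) (by fun_prop)]
  rfl

theorem map_fst_incrementLaw {s : ℝ≥0} (hs : 0 < s) (t r : ℝ≥0) :
    (incrementLaw P s t r).map (fun q => q.1) = outputLaw P s := by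
  refine Measure.ext_of_lintegral _ fun f hf => ?_
  rw [lintegral_map hf (by fun_prop), lintegral_incrementLaw _ _ _ (by fun_prop),
    lintegral_outputLaw _ hf]
  refine lintegral_congr fun a => ?_
  have : ∀ b, ∫⁻ c, ENNReal.ofReal (avgTilt P (s + t + r : ℝ≥0) (a + b + c)) * f a
      ∂(complexGaussian 0 r) = ENNReal.ofReal (avgTilt P (s + t : ℝ≥0) (a + b)) * f a := by
    intro b
    rw [lintegral_mul_const _ (by fun_prop), lintegral_avgTilt_add (by positivity)]
  simp_rw [this]
  rw [lintegral_mul_const _ (by fun_prop), lintegral_avgTilt_add hs]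

end

/-! ### Strict convexity of the output divergence and its Gaussian lower bound -/

namespace IsRegularPrior

variable {P : Measure ℂ} {c : ℝ}

theorem avgTilt_pos (hP : IsRegularPrior P c) {s : ℝ} (hs : 0 ≤ s) (w : ℂ) : 0 < avgTilt P s w :=
  hP.pos.trans_le (hP.le s hs w)

theorem integrable_log (hP : IsRegularPrior P c) {s : ℝ≥0} (hs : 0 < s) :
    Integrable (fun w => Real.log (avgTilt P s w)) (outputLaw P s) := by
  have := hP.prob
  rw [← map_eq_outputLaw hs, integrable_map_measure
    (by fun_prop : Measurable _).aestronglyMeasurable (by fun_prop)]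
  exact integrable_log_avgTilt s.2 hP.moment hP.pos (hP.le s s.2)

theorem integral_log_ratio (hP : IsRegularPrior P c) {s : ℝ≥0} (hs : 0 < s) {α : Type*}
    [MeasurableSpace α] {κ : Measure α} {φ : α → ℂ} (hφ : Measurable φ)
    (h : κ.map φ = outputLaw P s) :
    Integrable (fun q => Real.log (avgTilt P s (φ q))) κ ∧
      ∫ q, Real.log (avgTilt P s (φ q)) ∂κ = outputDiv P s := by
  have := hP.prob
  have hm : Measurable fun w => Real.log (avgTilt P s w) := by fun_prop
  constructor
  · have h1 := hP.integrable_log hs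
    rw [← h, integrable_map_measure hm.aestronglyMeasurable hφ.aemeasurable] at h1
    exact h1
  · rw [outputDiv_eq hs, ← h, integral_map hφ.aemeasurable hm.aestronglyMeasurable]

theorem eq_one_of_log_sub_one_add_inv_eq_zero {x : ℝ} (hx : 0 < x)
    (h : Real.log x - 1 + 1 / x = 0) : x = 1 := by
  by_contra hne
  have h1 : 1 / x ≠ 1 := by
    intro h2
    apply hne
    field_simp at h2
    exact h2.symm
  have h2 := Real.log_lt_sub_one_of_pos (one_div_pos.mpr hx) h1
  rw [one_div, Real.log_inv] at h2
  rw [one_div] at h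
  linarith

/-- The gap is the conditional mutual information of the last two increments given the first. In the
proof, `g` is the ratio of the conditionally independent law to the true law, so it has mean one
under `κ`. The hypothesis `hne` denies factorization when the first increment is `0`. -/
theorem outputDiv_add_lt (hP : IsRegularPrior P c) {s t : ℝ≥0} (hs : 0 < s) (ht : 0 < t)
    {r : ℝ≥0} (hr : 0 < r) (hne : ∃ b c, avgTilt P (s + t + r : ℝ≥0) (b + c) * avgTilt P s 0 ≠
      avgTilt P (s + t : ℝ≥0) b * avgTilt P (s + r : ℝ≥0) c) :
    outputDiv P (s + t : ℝ≥0) + outputDiv P (s + r : ℝ≥0) <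
      outputDiv P (s + t + r : ℝ≥0) + outputDiv P s := by
  have := hP.prob
  set κ := incrementLaw P s t r with hκ
  set Q := (complexGaussian 0 s).prod ((complexGaussian 0 t).prod (complexGaussian 0 r)) with hQ
  have hpos : ∀ (u : ℝ≥0) w, 0 < avgTilt P u w := fun u w => hP.avgTilt_pos u.2 w
  have hκp : IsProbabilityMeasure κ := by
    have h1 := map_sum_incrementLaw (P := P) s t r
    have := isProbabilityMeasure_outputLaw (P := P) (s := s + t + r) (by positivity)
    constructor
    have h2 : (outputLaw P (s + t + r)) univ = 1 := measure_univ
    rwa [← h1, Measure.map_apply (by fun_prop) MeasurableSet.univ] at h2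
  obtain ⟨i1, e1⟩ := hP.integral_log_ratio (s := s + t + r) (by positivity) (by fun_prop)
    (map_sum_incrementLaw (P := P) s t r)
  obtain ⟨i2, e2⟩ := hP.integral_log_ratio (s := s + t) (by positivity) (by fun_prop)
    (map_add_incrementLaw (P := P) hs t r)
  obtain ⟨i3, e3⟩ := hP.integral_log_ratio (s := s + r) (by positivity) (by fun_prop)
    (map_add_incrementLaw' (P := P) hs t r)
  obtain ⟨i4, e4⟩ := hP.integral_log_ratio hs (by fun_prop) (map_fst_incrementLaw (P := P) hs t r)
  set g : ℂ × ℂ × ℂ → ℝ := fun q =>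
    avgTilt P (s + t : ℝ≥0) (q.1 + q.2.1) * avgTilt P (s + r : ℝ≥0) (q.1 + q.2.2) /
      (avgTilt P (s + t + r : ℝ≥0) (q.1 + q.2.1 + q.2.2) * avgTilt P s q.1) with hg
  have hgm : Measurable g := by fun_prop
  have hgpos : ∀ q, 0 < g q := fun q =>
    div_pos (mul_pos (hpos _ _) (hpos _ _)) (mul_pos (hpos _ _) (hpos _ _))
  have hgl : ∫⁻ q, ENNReal.ofReal (g q) ∂κ = 1 := by
    rw [hκ, lintegral_incrementLaw _ _ _ (by fun_prop)]
    have h1 : ∀ a b c, ENNReal.ofReal (avgTilt P (s + t + r : ℝ≥0) (a + b + c)) *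
        ENNReal.ofReal (g (a, b, c)) =
        ENNReal.ofReal (avgTilt P (s + t : ℝ≥0) (a + b) / avgTilt P s a) *
          ENNReal.ofReal (avgTilt P (s + r : ℝ≥0) (a + c)) := by
      intro a b c
      rw [← ENNReal.ofReal_mul (hpos _ _).le,
        ← ENNReal.ofReal_mul (div_pos (hpos _ _) (hpos _ _)).le]
      congr 1
      have := (hpos (s + t + r) (a + b + c)).ne'
      have := (hpos s a).ne'
      simp only [hg]
      field_simp
    simp_rw [h1]
    have h2 : ∀ a b, ∫⁻ c, ENNReal.ofReal (avgTilt P (s + t : ℝ≥0) (a + b) / avgTilt P s a) *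
          ENNReal.ofReal (avgTilt P (s + r : ℝ≥0) (a + c)) ∂(complexGaussian 0 r) =
        ENNReal.ofReal (avgTilt P (s + t : ℝ≥0) (a + b)) := by
      intro a b
      rw [lintegral_const_mul _ (by fun_prop), lintegral_avgTilt_add hs,
        ← ENNReal.ofReal_mul (div_pos (hpos _ _) (hpos _ _)).le,
        div_mul_cancel₀ _ (hpos _ _).ne']
    simp_rw [h2, lintegral_avgTilt_add hs]
    exact lintegral_avgTilt hs
  have hgi : Integrable g κ := by
    refine ⟨hgm.aestronglyMeasurable, ?_⟩
    rw [hasFiniteIntegral_iff_ofReal (ae_of_all _ fun q => (hgpos q).le), hgl]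
    exact ENNReal.one_lt_top
  have hge : ∫ q, g q ∂κ = 1 := by
    rw [integral_eq_lintegral_of_nonneg_ae (ae_of_all _ fun q => (hgpos q).le)
      hgm.aestronglyMeasurable, hgl, ENNReal.toReal_one]
  -- This is `-log g - 1 + g`. Adding `g - 1`, of mean zero, makes the integrand pointwise
  -- nonnegative, with zeros only where `g = 1`.
  set h : ℂ × ℂ × ℂ → ℝ := fun q =>
    (Real.log (avgTilt P (s + t + r : ℝ≥0) (q.1 + q.2.1 + q.2.2)) + Real.log (avgTilt P s q.1) -
      (Real.log (avgTilt P (s + t : ℝ≥0) (q.1 + q.2.1)) +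
        Real.log (avgTilt P (s + r : ℝ≥0) (q.1 + q.2.2)))) - 1 + g q with hh
  have hlog : ∀ q, h q = Real.log (1 / g q) - 1 + 1 / (1 / g q) := by
    intro q
    rw [one_div_one_div, one_div, Real.log_inv, hg]
    dsimp only
    rw [Real.log_div (mul_pos (hpos _ _) (hpos _ _)).ne' (mul_pos (hpos _ _) (hpos _ _)).ne',
      Real.log_mul (hpos _ _).ne' (hpos _ _).ne', Real.log_mul (hpos _ _).ne' (hpos _ _).ne']
    simp only [hh, hg]
    ring
  have hnn : ∀ q, 0 ≤ h q := by
    intro q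
    rw [hlog, one_div_one_div, one_div, Real.log_inv]
    have := Real.log_le_sub_one_of_pos (hgpos q)
    linarith
  have hi14 : Integrable (fun q : ℂ × ℂ × ℂ =>
    Real.log (avgTilt P (s + t + r : ℝ≥0) (q.1 + q.2.1 + q.2.2)) + Real.log (avgTilt P s q.1)) κ :=
    i1.add i4
  have hi23 : Integrable (fun q : ℂ × ℂ × ℂ =>
    Real.log (avgTilt P (s + t : ℝ≥0) (q.1 + q.2.1)) +
        Real.log (avgTilt P (s + r : ℝ≥0) (q.1 + q.2.2))) κ := i2.add i3
  have hhi : Integrable h κ := ((hi14.sub hi23).sub (integrable_const 1)).add hgi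
  have hint : ∫ q, h q ∂κ = outputDiv P (s + t + r : ℝ≥0) + outputDiv P s -
      (outputDiv P (s + t : ℝ≥0) + outputDiv P (s + r : ℝ≥0)) := by
    have h1 : ∫ q, h q ∂κ = _ :=
      integral_add ((hi14.sub hi23).sub (integrable_const 1)) hgi
    have h2 := integral_sub (hi14.sub hi23) (integrable_const (μ := κ) (1 : ℝ))
    have h3 := integral_sub hi14 hi23
    have h4 := integral_add i1 i4
    have h5 := integral_add i2 i3
    simp only [Pi.sub_apply] at h1 h2
    rw [h1, h2, h3, h4, h5, hge, e1, e2, e3, e4]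
    simp
  suffices 0 < ∫ q, h q ∂κ by rw [hint] at this; linarith
  refine lt_of_le_of_ne (integral_nonneg hnn) fun h0 => ?_
  rw [eq_comm, integral_eq_zero_iff_of_nonneg hnn hhi] at h0
  -- The density of `κ` is positive, so the equality case passes to the Gaussian reference `Q`,
  -- which has full support.
  have hQκ : Q ≪ κ := by
    refine withDensity_absolutelyContinuous' (by fun_prop) (ae_of_all _ fun q => ?_)
    simpa using hpos (s + t + r) (q.1 + q.2.1 + q.2.2)
  have h1 : (fun q : ℂ × ℂ × ℂ =>
      avgTilt P (s + t + r : ℝ≥0) (q.1 + q.2.1 + q.2.2) * avgTilt P s q.1) =ᵐ[Q] fun q =>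
      avgTilt P (s + t : ℝ≥0) (q.1 + q.2.1) * avgTilt P (s + r : ℝ≥0) (q.1 + q.2.2) := by
    filter_upwards [hQκ.ae_le h0] with q hq
    rw [hlog] at hq
    have h2 := eq_one_of_log_sub_one_add_inv_eq_zero (one_div_pos.mpr (hgpos q)) hq
    have h3 : g q = 1 := by
      have := hgpos q
      field_simp at h2
      exact h2.symm
    exact ((div_eq_one_iff_eq (mul_pos (hpos _ _) (hpos _ _)).ne').mp h3).symm
  have : NeZero s := ⟨hs.ne'⟩
  have : NeZero t := ⟨ht.ne'⟩
  have : NeZero r := ⟨hr.ne'⟩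
  have hc := fun u : ℝ≥0 => hP.cont u u.2
  have h4 := (Continuous.ae_eq_iff_eq Q
    (((hc _).comp (by fun_prop)).mul ((hc _).comp (by fun_prop)))
    (((hc _).comp (by fun_prop)).mul ((hc _).comp (by fun_prop)))).mp h1
  obtain ⟨b, c, hbc⟩ := hne
  have h5 := congrFun h4 (0, b, c)
  exact hbc (by simpa using h5)

/-- Increments of the divergence of the output law are strictly increasing. -/
theorem outputDiv_add_lt_add (hP : IsRegularPrior P c) {s t r : ℝ} (hs : 0 < s) (ht : 0 < t)
    (hr : 0 < r) :
    outputDiv P (s + t) + outputDiv P (s + r) < outputDiv P (s + t + r) + outputDiv P s := by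
  lift s to ℝ≥0 using hs.le
  lift t to ℝ≥0 using ht.le
  lift r to ℝ≥0 using hr.le
  refine outputDiv_add_lt hP (by exact_mod_cast hs) (by exact_mod_cast ht)
    (by exact_mod_cast hr) ?_
  -- Factorization at `(w, -w)`, `(w, 0)`, `(0, -w)` and `(0, 0)` forces `F(w) F(-w) = F(0)²`, which
  -- the field `ne` rules out.
  by_contra! hcon
  obtain ⟨w, hw⟩ := hP.ne (s + t + r : ℝ≥0) (s + t + r).2
  have hk := hP.avgTilt_pos s.2 0
  have e1 := hcon w (-w)
  have e2 := hcon w 0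
  have e3 := hcon 0 (-w)
  have e4 := hcon 0 0
  rw [add_neg_cancel] at e1
  rw [add_zero] at e2 e4
  rw [zero_add] at e3
  apply hw
  have h2 : avgTilt P (s : ℝ) 0 ^ 2 ≠ 0 := (pow_pos hk 2).ne'
  apply mul_right_cancel₀ h2
  set F := avgTilt P ((s + t + r : ℝ≥0) : ℝ)
  linear_combination F (-w) * avgTilt P (s : ℝ) 0 * e2 +
    avgTilt P ((s + t : ℝ≥0) : ℝ) w * avgTilt P ((s + r : ℝ≥0) : ℝ) 0 * e3 -
    avgTilt P ((s + t : ℝ≥0) : ℝ) 0 * avgTilt P ((s + r : ℝ≥0) : ℝ) 0 * e1 -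
    F 0 * avgTilt P (s : ℝ) 0 * e4

/-- Among priors of given second moment the centred Gaussian one minimizes the divergence of the
output law. -/
theorem le_outputDiv (hP : IsRegularPrior P c) {s : ℝ} (hs : 0 < s) :
    s * ∫ x, ‖x‖ ^ 2 ∂P - 1 - Real.log (1 + s * ∫ x, ‖x‖ ^ 2 ∂P) ≤ outputDiv P s := by
  have := hP.prob
  lift s to ℝ≥0 using hs.le
  have hs' : 0 < s := by exact_mod_cast hs
  have hv0 : 0 ≤ ∫ x, ‖x‖ ^ 2 ∂P := integral_nonneg fun x => by positivity
  obtain ⟨v, hv⟩ : ∃ v : ℝ≥0, (v : ℝ) = ∫ x, ‖x‖ ^ 2 ∂P := ⟨⟨_, hv0⟩, rfl⟩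
  rw [← hv]
  set r : ℂ → ℝ := avgTilt (complexGaussian 0 v) s with hr
  have hrm : Measurable r := measurable_avgTilt _
  have hre : ∀ w, r w = gaussianTilt 0 v s w := by
    intro w
    have h1 := ofReal_avgTilt (P := complexGaussian 0 v) hs w
    rw [lintegral_tilt_left 0 v hs.le] at h1
    have h2 : 0 ≤ gaussianTilt 0 v s w := by unfold gaussianTilt; positivity
    have h3 : 0 ≤ r w := integral_nonneg fun x => (tilt_pos _ _ _).le
    exact (ENNReal.ofReal_eq_ofReal_iff h3 h2).mp h1
  have hk : (0 : ℝ) < 1 + s * v := by positivity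
  have hlogr : ∀ w, Real.log (r w) = v / (1 + s * v) * ‖w‖ ^ 2 - Real.log (1 + s * v) := by
    intro w
    rw [hre, gaussianTilt, Real.log_div (Real.exp_ne_zero _) hk.ne', Real.log_exp,
      Complex.sq_norm, Complex.normSq_apply]
    simp
    ring
  have hrpos : ∀ w, 0 < r w := by
    intro w
    rw [hre]
    unfold gaussianTilt
    positivity
  have hpos : ∀ w, 0 < avgTilt P s w := hP.avgTilt_pos s.2
  have hl : ∫⁻ w, ENNReal.ofReal (r w / avgTilt P s w) ∂(outputLaw P s) = 1 := by
    rw [lintegral_outputLaw _ (by fun_prop), ← lintegral_avgTilt (P := complexGaussian 0 v) hs']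
    refine lintegral_congr fun w => ?_
    rw [← ENNReal.ofReal_mul (hpos w).le, mul_div_cancel₀ _ (hpos w).ne']
  have hgi : Integrable (fun w => r w / avgTilt P s w) (outputLaw P s) := by
    refine ⟨(by fun_prop : Measurable _).aestronglyMeasurable, ?_⟩
    rw [hasFiniteIntegral_iff_ofReal (ae_of_all _ fun q => (div_pos (hrpos q) (hpos q)).le), hl]
    exact ENNReal.one_lt_top
  have hge : ∫ w, r w / avgTilt P s w ∂(outputLaw P s) = 1 := by
    rw [integral_eq_lintegral_of_nonneg_ae (ae_of_all _ fun q => (div_pos (hrpos q) (hpos q)).le)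
      (by fun_prop : Measurable _).aestronglyMeasurable, hl, ENNReal.toReal_one]
  have := isProbabilityMeasure_outputLaw (P := P) hs'
  have hG : Integrable (fun z : ℂ => ‖z‖ ^ 2) (complexGaussian 0 1) :=
    integrable_norm_sq_complexGaussian 0 1
  have hn : ∀ q : ℂ × ℂ, ‖(s : ℂ) * q.1 + Real.sqrt s * q.2‖ ^ 2 = (s : ℝ) ^ 2 * ‖q.1‖ ^ 2 +
      (2 * s * Real.sqrt s * (q.1.re * q.2.re + q.1.im * q.2.im) + s * ‖q.2‖ ^ 2) := by
    intro q
    have h := Real.mul_self_sqrt hs.le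
    rw [Complex.sq_norm, Complex.sq_norm, Complex.sq_norm, Complex.normSq_apply,
      Complex.normSq_apply, Complex.normSq_apply]
    simp
    linear_combination (q.2.re ^ 2 + q.2.im ^ 2) * h
  have j1 : Integrable (fun q : ℂ × ℂ => (s : ℝ) ^ 2 * ‖q.1‖ ^ 2)
      (P.prod (complexGaussian 0 1)) := (hP.moment.comp_fst _).const_mul _
  have j2 := (integrable_inner hP.moment).const_mul (2 * s * Real.sqrt s)
  have j3 : Integrable (fun q : ℂ × ℂ => s * ‖q.2‖ ^ 2)
      (P.prod (complexGaussian 0 1)) := (hG.comp_snd _).const_mul _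
  have hsm : Measurable fun q : ℂ × ℂ => (s : ℂ) * q.1 + Real.sqrt s * q.2 := by fun_prop
  have hni : Integrable (fun w => ‖w‖ ^ 2) (outputLaw P s) := by
    rw [← map_eq_outputLaw hs', integrable_map_measure
      (by fun_prop : Measurable _).aestronglyMeasurable hsm.aemeasurable]
    exact (j1.add (j2.add j3)).congr (ae_of_all _ fun q => (hn q).symm)
  have hne : (s : ℝ) ^ 2 * v ≤ ∫ w, ‖w‖ ^ 2 ∂(outputLaw P s) := by
    rw [← map_eq_outputLaw hs', integral_map hsm.aemeasurable
      (by fun_prop : Measurable _).aestronglyMeasurable]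
    simp only [hn]
    have k1 := integral_add j1 (j2.add j3)
    have k2 := integral_add j2 j3
    simp only [Pi.add_apply] at k1
    rw [k1, k2, integral_const_mul, integral_const_mul, integral_const_mul,
      integral_inner hP.moment, integral_fun_fst (f := fun x : ℂ => ‖x‖ ^ 2), hv]
    have : 0 ≤ ∫ q : ℂ × ℂ, ‖q.2‖ ^ 2 ∂(P.prod (complexGaussian 0 1)) :=
      integral_nonneg fun q => by positivity
    simp
    positivity
  have hri : Integrable (fun w => Real.log (r w)) (outputLaw P s) := by
    simp only [hlogr]
    exact (hni.const_mul _).sub (integrable_const _)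
  -- Gibbs' inequality against the output density `r` of the prior `CN(0, v)`, in the form `log x ≤
  -- x - 1` for the ratio of densities.
  have hmain : ∫ w, (Real.log (r w) + 1 - r w / avgTilt P s w) ∂(outputLaw P s) ≤
      outputDiv P s := by
    rw [outputDiv_eq hs']
    refine integral_mono ((hri.add (integrable_const _)).sub hgi) (hP.integrable_log hs')
      fun w => ?_
    have h1 := Real.log_le_sub_one_of_pos (div_pos (hrpos w) (hpos w))
    rw [Real.log_div (hrpos w).ne' (hpos w).ne'] at h1
    dsimp only
    linarith
  have hsum : ∫ w, (Real.log (r w) + 1 - r w / avgTilt P s w) ∂(outputLaw P s) =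
      v / (1 + s * v) * ∫ w, ‖w‖ ^ 2 ∂(outputLaw P s) - Real.log (1 + s * v) := by
    have h1 := integral_sub (hri.add (integrable_const (1 : ℝ))) hgi
    have h2 := integral_add hri (integrable_const (μ := outputLaw P s) (1 : ℝ))
    have h3 := integral_sub (hni.const_mul (v / (1 + s * v)))
      (integrable_const (μ := outputLaw P s) (Real.log (1 + s * v)))
    simp only [Pi.add_apply] at h1
    rw [h1, h2, hge]
    simp only [hlogr]
    rw [h3, integral_const_mul]
    simp
  rw [hsum] at hmain
  -- The bound `hne` drops the noise energy; this costs `s v / (1 + s v) ≤ 1`, the source of the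
  -- `-1`.
  have h4 : s * v - 1 ≤ v / (1 + s * v) * ∫ w, ‖w‖ ^ 2 ∂(outputLaw P s) := by
    have h5 : v / (1 + s * v) * ((s : ℝ) ^ 2 * v) ≤
        v / (1 + s * v) * ∫ w, ‖w‖ ^ 2 ∂(outputLaw P s) := by gcongr
    refine le_trans ?_ h5
    rw [div_mul_eq_mul_div, le_div_iff₀ hk]
    nlinarith
  linarith

end IsRegularPrior

/-! ### The Bernoulli-Gaussian prior -/

theorem isProbabilityMeasure_bernoulliGaussian (m : ℂ) (v : ℝ≥0) {γ : ℝ} (hγ : γ ∈ Ioo (0 : ℝ) 1) :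
    IsProbabilityMeasure (bernoulliGaussian m v γ) := by
  constructor
  have h1 : 0 ≤ 1 - γ := by linarith [hγ.2]
  simp only [bernoulliGaussian, Measure.add_apply, Measure.smul_apply, measure_univ, smul_eq_mul,
    mul_one]
  rw [← ENNReal.ofReal_add h1 hγ.1.le]
  simp

theorem integrable_bernoulliGaussian {m : ℂ} {v : ℝ≥0} (γ : ℝ) {f : ℂ → ℝ}
    (hfm : Measurable f) (hf : Integrable f (complexGaussian m v)) :
    Integrable f (bernoulliGaussian m v γ) := by
  refine Integrable.add_measure ?_ ?_
  · exact (integrable_dirac' hfm.stronglyMeasurable (by simp)).smul_measure ENNReal.ofReal_ne_top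
  · exact hf.smul_measure ENNReal.ofReal_ne_top

theorem integral_bernoulliGaussian {m : ℂ} {v : ℝ≥0} {γ : ℝ} (hγ : γ ∈ Ioo (0 : ℝ) 1) {f : ℂ → ℝ}
    (hfm : Measurable f) (hf : Integrable f (complexGaussian m v)) :
    ∫ x, f x ∂(bernoulliGaussian m v γ) = (1 - γ) * f 0 + γ * ∫ x, f x ∂(complexGaussian m v) := by
  have h1 : 0 ≤ 1 - γ := by linarith [hγ.2]
  rw [bernoulliGaussian, integral_add_measure, integral_smul_measure, integral_smul_measure,
    integral_dirac' _ _ hfm.stronglyMeasurable, ENNReal.toReal_ofReal h1,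
    ENNReal.toReal_ofReal hγ.1.le, smul_eq_mul, smul_eq_mul]
  · exact (integrable_dirac' hfm.stronglyMeasurable (by simp)).smul_measure ENNReal.ofReal_ne_top
  · exact hf.smul_measure ENNReal.ofReal_ne_top

theorem gaussianTilt_pos (m : ℂ) (v : ℝ≥0) {s : ℝ} (hs : 0 ≤ s) (w : ℂ) :
    0 < gaussianTilt m v s w := by
  unfold gaussianTilt
  positivity

/-- The atom at `0` contributes the constant `1 - γ`, which is also the uniform lower bound required
of a regular prior. -/
theorem avgTilt_bernoulliGaussian (m : ℂ) (v : ℝ≥0) {γ : ℝ} (hγ : γ ∈ Ioo (0 : ℝ) 1) {s : ℝ}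
    (hs : 0 ≤ s) (w : ℂ) :
    avgTilt (bernoulliGaussian m v γ) s w = 1 - γ + γ * gaussianTilt m v s w := by
  have hl := lintegral_tilt_left m v hs w
  have hm : Measurable fun x => tilt s x w := by fun_prop
  have hi : Integrable (fun x => tilt s x w) (complexGaussian m v) := by
    refine ⟨hm.aestronglyMeasurable, ?_⟩
    rw [hasFiniteIntegral_iff_ofReal (ae_of_all _ fun q => (tilt_pos _ _ _).le), hl]
    exact ENNReal.ofReal_lt_top
  rw [avgTilt, integral_bernoulliGaussian hγ hm hi,
    integral_eq_lintegral_of_nonneg_ae (ae_of_all _ fun q => (tilt_pos _ _ _).le)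
      hm.aestronglyMeasurable, hl, ENNReal.toReal_ofReal (gaussianTilt_pos m v hs w).le]
  simp [tilt]

theorem two_lt_exp_add_exp {a b : ℝ} (ha : 0 ≤ a) (hab : a ≠ 0 ∨ b ≠ 0) :
    2 < Real.exp (a + b) + Real.exp (a - b) := by
  by_cases h : a + b = 0
  · have h2 : a - b ≠ 0 := by
      intro h2
      have ha' : a = 0 := by linarith
      have hb' : b = 0 := by linarith
      tauto
    linarith [Real.add_one_lt_exp h2, Real.add_one_le_exp (a + b)]
  · linarith [Real.add_one_lt_exp h, Real.add_one_le_exp (a - b)]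

theorem isRegularPrior_bernoulliGaussian {m : ℂ} {v : ℝ≥0} {γ : ℝ} (hγ : γ ∈ Ioo (0 : ℝ) 1)
    (h0 : m ≠ 0 ∨ 0 < v) : IsRegularPrior (bernoulliGaussian m v γ) (1 - γ) where
  prob := isProbabilityMeasure_bernoulliGaussian m v hγ
  moment := integrable_bernoulliGaussian γ (by fun_prop) (integrable_norm_sq_complexGaussian m v)
  pos := by linarith [hγ.2]
  le s hs w := by
    rw [avgTilt_bernoulliGaussian m v hγ hs]
    have := mul_pos hγ.1 (gaussianTilt_pos m v hs w)
    linarith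
  cont s hs := by
    have : avgTilt (bernoulliGaussian m v γ) s = fun w => 1 - γ + γ * gaussianTilt m v s w :=
      funext fun w => avgTilt_bernoulliGaussian m v hγ hs w
    rw [this]
    unfold gaussianTilt
    fun_prop
  -- Write `F(±w) = 1 - γ + γ K exp(a ± b)` with `a ≥ 0` even and `b` odd in `w`, and let `E`, `E'`
  -- be the two exponentials. Then `F(w) F(-w) - F(0)²` equals `(1 - γ) γ K (E + E' - 2) + (γ K)² (E
  -- E' - 1)`, whose first term is positive once `a` or `b` is nonzero.
  ne s hs := by
    have hk : 0 < 1 + s * v := by positivity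
    simp only [avgTilt_bernoulliGaussian m v hγ hs]
    set K := gaussianTilt m v s 0 with hK
    have hKpos : 0 < K := gaussianTilt_pos m v hs 0
    have hsplit : ∀ w, gaussianTilt m v s w = K * Real.exp (v * (w.re ^ 2 + w.im ^ 2) / (1 + s * v) +
        2 * (w.re * m.re + w.im * m.im) / (1 + s * v)) := by
      intro w
      rw [hK, gaussianTilt, gaussianTilt, div_mul_eq_mul_div, ← Real.exp_add]
      congr 2
      simp
      ring
    -- A nonzero mean is detected by `w = m`, a nonzero variance by `w = 1`.
    obtain ⟨w, hw⟩ : ∃ w : ℂ, v * (w.re ^ 2 + w.im ^ 2) / (1 + s * v) ≠ 0 ∨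
        2 * (w.re * m.re + w.im * m.im) / (1 + s * v) ≠ 0 := by
      rcases h0 with h0 | h0
      · refine ⟨m, Or.inr (div_ne_zero ?_ hk.ne')⟩
        intro h1
        exact h0 (Complex.normSq_eq_zero.mp (by rw [Complex.normSq_apply]; linarith))
      · refine ⟨1, Or.inl (div_ne_zero ?_ hk.ne')⟩
        have : (v : ℝ) ≠ 0 := by exact_mod_cast h0.ne'
        simpa using this
    refine ⟨w, ?_⟩
    have ha : 0 ≤ v * (w.re ^ 2 + w.im ^ 2) / (1 + s * v) := by positivity
    rw [hsplit w, hsplit (-w)]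
    have hneg : v * ((-w).re ^ 2 + (-w).im ^ 2) / (1 + s * v) +
        2 * ((-w).re * m.re + (-w).im * m.im) / (1 + s * v) =
        v * (w.re ^ 2 + w.im ^ 2) / (1 + s * v) - 2 * (w.re * m.re + w.im * m.im) / (1 + s * v) := by
      simp
      ring
    rw [hneg]
    set a := v * (w.re ^ 2 + w.im ^ 2) / (1 + s * v)
    set b := 2 * (w.re * m.re + w.im * m.im) / (1 + s * v)
    have h2 := two_lt_exp_add_exp ha hw
    have h3 : 1 ≤ Real.exp (a + b) * Real.exp (a - b) := by
      rw [← Real.exp_add, Real.one_le_exp_iff]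
      linarith
    set E := Real.exp (a + b)
    set E' := Real.exp (a - b)
    have hγ1 : 0 < 1 - γ := by linarith [hγ.2]
    have h4 : 0 < (1 - γ) * (γ * K) * (E + E' - 2) :=
      mul_pos (mul_pos hγ1 (mul_pos hγ.1 hKpos)) (by linarith)
    have h5 : 0 ≤ (γ * K) ^ 2 * (E * E' - 1) := mul_nonneg (sq_nonneg _) (by linarith)
    intro h6
    nlinarith

/-! ### Differentiability of the output divergence -/

/-- Differentiation under the integral: since `|S'| ≤ 1`, the derivative is dominated by `∑ C i ‖f
i‖`, where `C i` bounds the derivative of `a i` on `[s₀ / 2, 2 s₀]`. -/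
theorem differentiableAt_integral_comp_sum {Ω ι : Type*} [MeasurableSpace Ω] [Fintype ι]
    {μ : Measure Ω} [IsFiniteMeasure μ] {S S' : ℝ → ℝ} (hS : ∀ x, HasDerivAt S (S' x) x)
    (hS' : ∀ x, |S' x| ≤ 1) {a : ι → ℝ → ℝ} (ha : ∀ i, ∀ s, 0 < s → ContDiffAt ℝ 1 (a i) s)
    {f : ι → Ω → ℝ} (hf : ∀ i, Integrable (f i) μ) {s₀ : ℝ} (hs₀ : 0 < s₀) :
    DifferentiableAt ℝ (fun s => ∫ ω, S (∑ i, a i s * f i ω) ∂μ) s₀ := by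
  have hSc : Continuous S := continuous_iff_continuousAt.mpr fun x => (hS x).continuousAt
  have hSd : deriv S = S' := funext fun x => (hS x).deriv
  have hS'm : Measurable S' := hSd ▸ measurable_deriv S
  have hlip : LipschitzWith 1 S := lipschitzWith_of_nnnorm_deriv_le
    (fun x => (hS x).differentiableAt) fun x => by
      rw [hSd, ← NNReal.coe_le_coe]
      simpa using hS' x
  have hsum : ∀ s, Integrable (fun ω => ∑ i, a i s * f i ω) μ := fun s =>
    integrable_finsetSum _ fun i _ => (hf i).const_mul _
  have hC : ∀ i, ∃ C, ∀ s ∈ Icc (s₀ / 2) (2 * s₀), ‖deriv (a i) s‖ ≤ C := by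
    intro i
    have h1 : ContDiffOn ℝ 1 (a i) (Ioi 0) := fun s hs => (ha i s hs).contDiffWithinAt
    have h2 := h1.continuousOn_deriv_of_isOpen isOpen_Ioi le_rfl
    exact isCompact_Icc.exists_bound_of_continuousOn
      (h2.mono fun s hs => (by linarith [hs.1] : (0 : ℝ) < s))
  choose C hC using hC
  refine (hasDerivAt_integral_of_dominated_loc_of_deriv_le (s := Ioo (s₀ / 2) (2 * s₀))
    (F := fun s ω => S (∑ i, a i s * f i ω))
    (F' := fun s ω => S' (∑ i, a i s * f i ω) * ∑ i, deriv (a i) s * f i ω)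
    (bound := fun ω => ∑ i, C i * ‖f i ω‖)
    (Ioo_mem_nhds (by linarith) (by linarith)) ?_ ?_ ?_ ?_ ?_ ?_).2.differentiableAt
  · exact Filter.Eventually.of_forall fun s =>
      hSc.comp_aestronglyMeasurable (hsum s).aestronglyMeasurable
  · have hb : Integrable (fun ω => |S 0| + ‖∑ i, a i s₀ * f i ω‖) μ :=
      (integrable_const _).add (hsum s₀).norm
    refine hb.mono' (hSc.comp_aestronglyMeasurable (hsum s₀).aestronglyMeasurable)
      (ae_of_all _ fun ω => ?_)
    have h1 := hlip.dist_le_mul (∑ i, a i s₀ * f i ω) 0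
    rw [dist_zero_right, NNReal.coe_one, one_mul, Real.dist_eq] at h1
    have h2 := abs_sub_abs_le_abs_sub (S (∑ i, a i s₀ * f i ω)) (S 0)
    rw [Real.norm_eq_abs]
    linarith
  · refine AEStronglyMeasurable.mul ?_ ?_
    · exact (hS'm.comp_aemeasurable (hsum s₀).aestronglyMeasurable.aemeasurable).aestronglyMeasurable
    · exact (integrable_finsetSum _ fun i _ => (hf i).const_mul _).aestronglyMeasurable
  · refine ae_of_all _ fun ω s hs => ?_
    rw [norm_mul]
    calc ‖S' (∑ i, a i s * f i ω)‖ * ‖∑ i, deriv (a i) s * f i ω‖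
        ≤ 1 * ‖∑ i, deriv (a i) s * f i ω‖ := by gcongr; exact hS' _
      _ ≤ ∑ i, ‖deriv (a i) s * f i ω‖ := by rw [one_mul]; exact norm_sum_le _ _
      _ ≤ ∑ i, C i * ‖f i ω‖ := by
          refine Finset.sum_le_sum fun i _ => ?_
          rw [norm_mul]
          gcongr
          exact hC i s (Ioo_subset_Icc_self hs)
  · exact integrable_finsetSum _ fun i _ => (hf i).norm.const_mul _
  · refine ae_of_all _ fun ω s hs => ?_
    have h1 : HasDerivAt (fun s => ∑ i, a i s * f i ω) (∑ i, deriv (a i) s * f i ω) s := by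
      refine HasDerivAt.fun_sum fun i _ => ?_
      exact (((ha i s (by linarith [hs.1])).differentiableAt one_ne_zero).hasDerivAt).mul_const _
    exact (hS _).comp s h1

theorem differentiableAt_outputDiv (m : ℂ) (v : ℝ≥0) {γ : ℝ} (hγ : γ ∈ Ioo (0 : ℝ) 1) {s₀ : ℝ}
    (hs₀ : 0 < s₀) : DifferentiableAt ℝ (outputDiv (bernoulliGaussian m v γ)) s₀ := by
  have := isProbabilityMeasure_bernoulliGaussian m v hγ
  have hP2 : Integrable (fun x => ‖x‖ ^ 2) (bernoulliGaussian m v γ) :=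
    integrable_bernoulliGaussian γ (by fun_prop) (integrable_norm_sq_complexGaussian m v)
  have hG2 := integrable_norm_sq_complexGaussian 0 1
  have hP1 := integrable_id_of_norm_sq hP2
  have hG1 := integrable_id_of_norm_sq hG2
  have hγ1 : 0 < 1 - γ := by linarith [hγ.2]
  -- Expansion of `log (gaussianTilt m v s (s x + √s z))` into smooth functions of `s` times
  -- integrable functions of `(x, z)`. The logarithm of `F_s` is then `S = log(1 - γ + γ exp ·)` of
  -- this sum.
  set a : Fin 6 → ℝ → ℝ := ![fun s => v * s ^ 2 / (1 + s * v),
    fun s => 2 * v * s * Real.sqrt s / (1 + s * v), fun s => v * s / (1 + s * v),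
    fun s => 2 * s / (1 + s * v), fun s => 2 * Real.sqrt s / (1 + s * v),
    fun s => -(s * (m.re ^ 2 + m.im ^ 2)) / (1 + s * v) - Real.log (1 + s * v)] with ha
  set f : Fin 6 → ℂ × ℂ → ℝ := ![fun q => ‖q.1‖ ^ 2,
    fun q => q.1.re * q.2.re + q.1.im * q.2.im, fun q => ‖q.2‖ ^ 2,
    fun q => q.1.re * m.re + q.1.im * m.im, fun q => q.2.re * m.re + q.2.im * m.im,
    fun _ => 1] with hf
  have hfi : ∀ i, Integrable (f i) ((bernoulliGaussian m v γ).prod (complexGaussian 0 1)) := by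
    intro i
    fin_cases i
    · exact hP2.comp_fst _
    · exact integrable_inner hP2
    · exact hG2.comp_snd _
    · exact ((hP1.re.mul_const _).add (hP1.im.mul_const _)).comp_fst _
    · exact ((hG1.re.mul_const _).add (hG1.im.mul_const _)).comp_snd _
    · exact integrable_const _
  have hac : ∀ i, ∀ s, 0 < s → ContDiffAt ℝ 1 (a i) s := by
    intro i s hs
    have hk : 1 + s * (v : ℝ) ≠ 0 := by positivity
    have hid : ContDiffAt ℝ 1 (fun s : ℝ => s) s := contDiffAt_id
    have hsq : ContDiffAt ℝ 1 (fun s : ℝ => Real.sqrt s) s := hid.sqrt hs.ne'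
    have hden : ContDiffAt ℝ 1 (fun s : ℝ => 1 + s * (v : ℝ)) s := by fun_prop
    fin_cases i
    · exact ContDiffAt.div (by fun_prop) hden hk
    · exact ContDiffAt.div (by fun_prop) hden hk
    · exact ContDiffAt.div (by fun_prop) hden hk
    · exact ContDiffAt.div (by fun_prop) hden hk
    · exact ContDiffAt.div (by fun_prop) hden hk
    · exact (ContDiffAt.div (by fun_prop) hden hk).sub (hden.log hk)
  have hSpos : ∀ x : ℝ, 0 < 1 - γ + γ * Real.exp x := fun x =>
    add_pos hγ1 (mul_pos hγ.1 (Real.exp_pos x))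
  have hd := differentiableAt_integral_comp_sum
    (S := fun x => Real.log (1 - γ + γ * Real.exp x))
    (S' := fun x => γ * Real.exp x / (1 - γ + γ * Real.exp x))
    (fun x => (((Real.hasDerivAt_exp x).const_mul γ).const_add (1 - γ)).log (hSpos x).ne')
    (fun x => by
      have h1 := mul_pos hγ.1 (Real.exp_pos x)
      rw [abs_of_nonneg (div_nonneg h1.le (hSpos x).le), div_le_one (hSpos x)]
      linarith) hac hfi hs₀
  refine hd.congr_of_eventuallyEq ?_
  filter_upwards [lt_mem_nhds hs₀] with s hs
  rw [outputDiv]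
  refine integral_congr_ae (ae_of_all _ fun q => ?_)
  dsimp only
  rw [avgTilt_bernoulliGaussian m v hγ hs.le]
  congr 3
  have hk : 0 < 1 + s * (v : ℝ) := by positivity
  rw [gaussianTilt, ← Real.exp_log hk, ← Real.exp_sub, Real.exp_log hk]
  congr 1
  have h := Real.mul_self_sqrt hs.le
  simp only [ha, hf, Fin.sum_univ_six, Complex.sq_norm, Complex.normSq_apply]
  simp
  field_simp
  linear_combination v * (q.2.re ^ 2 + q.2.im ^ 2) * h

section

open Filter Topology

/-! ### Concave rate curves and their perspectives -/

/-- Letting one increment tend to zero keeps only a weak inequality: `r'` is antitone. Strictness is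
recovered by the mean value theorem on the two halves of `[s, t]`, whose increments differ strictly.
-/
theorem strictConcaveOn_of_increments {r : ℝ → ℝ} (hd : ∀ s, 0 < s → DifferentiableAt ℝ r s)
    (h : ∀ s t u, 0 < s → 0 < t → 0 < u → r (s + t + u) + r s < r (s + t) + r (s + u)) :
    StrictConcaveOn ℝ (Ioi 0) r := by
  have hanti : ∀ s t, 0 < s → s < t → deriv r t ≤ deriv r s := by
    intro s t hs hst
    have h1 := (hd t (hs.trans hst)).hasDerivAt.tendsto_slope_zero_right
    have h2 := (hd s hs).hasDerivAt.tendsto_slope_zero_right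
    refine le_of_tendsto_of_tendsto h1 h2 ?_
    filter_upwards [self_mem_nhdsWithin] with e he
    have he' : (0 : ℝ) < e := he
    have h3 := h s e (t - s) hs he' (by linarith)
    rw [show s + e + (t - s) = t + e by ring, show s + (t - s) = t by ring] at h3
    simp only [smul_eq_mul]
    have : 0 < e⁻¹ := by positivity
    apply mul_le_mul_of_nonneg_left _ this.le
    linarith
  refine StrictAntiOn.strictConcaveOn_of_deriv (convex_Ioi 0)
    (fun s hs => (hd s hs).continuousAt.continuousWithinAt) ?_
  rw [interior_Ioi]
  intro s hs t ht hst
  have hs' : (0 : ℝ) < s := hs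
  set m := (s + t) / 2 with hm
  have hsm : s < m := by rw [hm]; linarith
  have hmt : m < t := by rw [hm]; linarith
  have hc : ∀ x y, 0 < x → ContinuousOn r (Icc x y) := fun x y hx z hz =>
    (hd z (hx.trans_le hz.1)).continuousAt.continuousWithinAt
  have hdo : ∀ x y, 0 < x → DifferentiableOn ℝ r (Ioo x y) := fun x y hx z hz =>
    (hd z (hx.trans hz.1)).differentiableWithinAt
  obtain ⟨x, hx, hxe⟩ := exists_deriv_eq_slope r hsm (hc s m hs') (hdo s m hs')
  obtain ⟨y, hy, hye⟩ := exists_deriv_eq_slope r hmt (hc m t (hs'.trans hsm)) (hdo m t (hs'.trans hsm))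
  have h3 := h s (m - s) (m - s) hs' (by linarith) (by linarith)
  rw [show s + (m - s) + (m - s) = t by rw [hm]; ring, show s + (m - s) = m by ring] at h3
  have h4 := hanti s x hs' hx.1
  have h5 := hanti y t (by linarith [hy.1]) hy.2
  have h6 : deriv r y < deriv r x := by
    rw [hxe, hye, show t - m = m - s by rw [hm]; ring]
    apply div_lt_div_of_pos_right _ (by linarith)
    linarith
  linarith

/-- A rate as a function of the signal-to-noise ratio: nonnegative, strictly concave,
differentiable and of sublinear growth. -/
structure IsRateCurve (r : ℝ → ℝ) : Prop where
  nonneg : ∀ s, 0 < s → 0 ≤ r s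
  concave : StrictConcaveOn ℝ (Ioi 0) r
  diff : ∀ s, 0 < s → DifferentiableAt ℝ r s
  lim : Tendsto (fun s => r s / s) atTop (𝓝 0)

theorem tendsto_div_of_le_log {r : ℝ → ℝ} {C m : ℝ} (hm : 0 ≤ m) (h0 : ∀ s, 0 < s → 0 ≤ r s)
    (h1 : ∀ s, 0 < s → r s ≤ C + Real.log (1 + s * m)) :
    Tendsto (fun s => r s / s) atTop (𝓝 0) := by
  have h2 : Tendsto (fun s : ℝ => (C + Real.log (1 + m)) / s + Real.log s / s) atTop (𝓝 0) := by
    have h3 := Real.isLittleO_log_id_atTop.tendsto_div_nhds_zero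
    have h4 : Tendsto (fun s : ℝ => (C + Real.log (1 + m)) / s) atTop (𝓝 0) :=
      tendsto_const_nhds.div_atTop tendsto_id
    simpa using h4.add h3
  refine tendsto_of_tendsto_of_tendsto_of_le_of_le' tendsto_const_nhds h2 ?_ ?_
  · filter_upwards [eventually_gt_atTop 0] with s hs
    exact div_nonneg (h0 s hs) hs.le
  · filter_upwards [eventually_ge_atTop 1] with s hs
    have hs0 : 0 < s := by linarith
    rw [← add_div]
    apply div_le_div_of_nonneg_right _ hs0.le
    refine (h1 s hs0).trans ?_
    rw [add_assoc, ← Real.log_mul (by positivity) hs0.ne']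
    gcongr
    nlinarith

theorem IsRateCurve.div_const {r : ℝ → ℝ} (h : IsRateCurve r) {c : ℝ} (hc : 0 < c) :
    IsRateCurve fun s => r s / c where
  nonneg s hs := div_nonneg (h.nonneg s hs) hc.le
  concave := by
    refine ⟨convex_Ioi 0, fun x hx y hy hxy a b ha hb hab => ?_⟩
    have h1 := h.concave.2 hx hy hxy ha hb hab
    simp only [smul_eq_mul] at h1 ⊢
    rw [← mul_div_assoc, ← mul_div_assoc, ← add_div]
    exact div_lt_div_of_pos_right h1 hc
  diff s hs := (h.diff s hs).div_const c
  lim := by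
    have h1 := h.lim.div_const c
    rw [zero_div] at h1
    refine h1.congr fun s => ?_
    rw [div_right_comm]

theorem isRateCurve_log : IsRateCurve fun s => Real.log (1 + s) where
  nonneg s hs := Real.log_nonneg (by linarith)
  concave := by
    refine ⟨convex_Ioi 0, fun x hx y hy hxy a b ha hb hab => ?_⟩
    have hx' : (0 : ℝ) < x := hx
    have hy' : (0 : ℝ) < y := hy
    have h1 := strictConcaveOn_log_Ioi.2 (show 1 + x ∈ Ioi (0 : ℝ) from by simp; linarith)
      (show 1 + y ∈ Ioi (0 : ℝ) from by simp; linarith) (by simpa using hxy) ha hb hab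
    simp only [smul_eq_mul] at h1 ⊢
    rwa [show a * (1 + x) + b * (1 + y) = 1 + (a * x + b * y) by linear_combination hab] at h1
  diff s hs := ((differentiableAt_id).const_add 1).log (by simp; linarith)
  lim := tendsto_div_of_le_log (C := 0) (m := 1) zero_le_one
    (fun s hs => Real.log_nonneg (by linarith)) fun s hs => by simp

namespace IsRateCurve

variable {r : ℝ → ℝ}

/-- A concave function that fails to increase somewhere eventually lies below a line of negative
slope, against nonnegativity. -/
theorem lt_of_lt (h : IsRateCurve r) {s t : ℝ} (hs : 0 < s) (hst : s < t) : r s < r t := by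
  by_contra! hle
  have ht : 0 < t := hs.trans hst
  have h1 := h.concave.slope_anti_adjacent (x := s) (y := t) (z := t + 1) hs
    (show (0 : ℝ) < t + 1 by linarith) hst (by linarith)
  have h2 : (r t - r s) / (t - s) ≤ 0 := div_nonpos_of_nonpos_of_nonneg (by linarith) (by linarith)
  rw [add_sub_cancel_left, div_one] at h1
  set σ := r t - r (t + 1) with hσ
  have hσ0 : 0 < σ := by linarith
  have hr0 := h.nonneg (t + 1) (by linarith)
  -- At `z` the line of slope `-σ` through the graph point over `t + 1` has height `-σ < 0`.
  set z := t + 1 + (r (t + 1) / σ + 1) with hz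
  have hq : 0 ≤ r (t + 1) / σ := by positivity
  have hz1 : t + 1 < z := by linarith
  have h3 := h.concave.slope_anti_adjacent (x := t) (y := t + 1) (z := z) ht
    (show (0 : ℝ) < z by linarith) (by linarith) hz1
  rw [show t + 1 - t = 1 by ring, div_one, div_lt_iff₀ (by linarith)] at h3
  have h4 := h.nonneg z (by linarith)
  have h5 : (r (t + 1) - r t) * (z - (t + 1)) = -r (t + 1) - σ := by
    rw [hz, add_sub_cancel_left, show r (t + 1) - r t = -σ by rw [hσ]; ring]
    field_simp
    ring
  linarith

theorem pos (h : IsRateCurve r) {s : ℝ} (hs : 0 < s) : 0 < r s :=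
  (h.nonneg (s / 2) (by linarith)).trans_lt (h.lt_of_lt (by linarith) (by linarith))

/-- Monotonicity of `r(s) / s`: otherwise the chord over `[s, t]`, extended to the left, meets zero
at a positive point. -/
theorem mul_le_mul_of_lt (h : IsRateCurve r) {s t : ℝ} (hs : 0 < s) (hst : s < t) :
    r t * s ≤ r s * t := by
  by_contra! hlt
  have ha : 0 < r t - r s := by linarith [h.lt_of_lt hs hst]
  have hb : 0 ≤ r s * (t - s) := mul_nonneg (h.nonneg s hs) (by linarith)
  -- Half of the zero of the chord: the chord is negative at `e`, and concavity puts `r e` below it.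
  set e := ((r t - r s) * s - r s * (t - s)) / (2 * (r t - r s)) with he
  have he0 : 0 < e := div_pos (by linarith) (by linarith)
  have hes : e < s := by
    rw [he, div_lt_iff₀ (by linarith)]
    nlinarith [mul_pos ha hs]
  have h1 := h.concave.slope_anti_adjacent (x := e) (y := s) (z := t) he0
    (show (0 : ℝ) < t by linarith) hes hst
  rw [div_lt_div_iff₀ (by linarith) (by linarith)] at h1
  have h2 := h.nonneg e he0
  have h3 : (r t - r s) * e = ((r t - r s) * s - r s * (t - s)) / 2 := by
    rw [he]
    field_simp
  have h4 : 0 ≤ r e * (t - s) := mul_nonneg h2 (by linarith)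
  nlinarith

theorem mul_lt_mul_of_lt (h : IsRateCurve r) {s t : ℝ} (hs : 0 < s) (hst : s < t) :
    r t * s < r s * t := by
  refine lt_of_le_of_ne (h.mul_le_mul_of_lt hs hst) fun heq => ?_
  have h1 := h.mul_le_mul_of_lt (s := s) (t := (s + t) / 2) hs (by linarith)
  have h2 := h.concave.2 (show s ∈ Ioi 0 from hs) (show t ∈ Ioi 0 from hs.trans hst) hst.ne
    (show (0 : ℝ) < 1 / 2 by norm_num) (show (0 : ℝ) < 1 / 2 by norm_num) (by norm_num)
  simp only [smul_eq_mul] at h2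
  rw [show 1 / 2 * s + 1 / 2 * t = (s + t) / 2 by ring] at h2
  nlinarith

/-- `τ ↦ τ r(k / τ)` is strictly increasing. -/
theorem strictMonoOn_perspective (h : IsRateCurve r) {k : ℝ} (hk : 0 < k) :
    StrictMonoOn (fun τ => τ * r (k / τ)) (Ici 0) := by
  intro a ha b hb hab
  have hb0 : 0 < b := lt_of_le_of_lt ha hab
  dsimp only
  rcases eq_or_lt_of_le (show (0 : ℝ) ≤ a from ha) with h0 | h0
  · rw [← h0, zero_mul]
    exact mul_pos hb0 (h.pos (by positivity))
  · have h1 := h.mul_lt_mul_of_lt (s := k / b) (t := k / a) (by positivity)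
      (div_lt_div_of_pos_left hk h0 hab)
    rw [mul_div_assoc', mul_div_assoc', div_lt_div_iff₀ hb0 h0] at h1
    refine lt_of_mul_lt_mul_right ?_ hk.le
    linarith

theorem strictConcaveOn_perspective (h : IsRateCurve r) {k : ℝ} (hk : 0 < k) :
    StrictConcaveOn ℝ (Ici 0) fun τ => τ * r (k / τ) := by
  -- Covers chords starting at `τ = 0`, where the perspective vanishes; strict monotonicity of `r`
  -- suffices. Between positive points, `r` is applied to `k / x` and `k / y` with weights
  -- proportional to `a x` and `b y`.
  have hzero : ∀ x b : ℝ, 0 < x → 0 < b → b < 1 →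
      b * (x * r (k / x)) < b * x * r (k / (b * x)) := by
    intro x b hx hb hb1
    rw [← mul_assoc]
    apply mul_lt_mul_of_pos_left _ (mul_pos hb hx)
    apply h.lt_of_lt (by positivity)
    apply div_lt_div_of_pos_left hk (by positivity)
    nlinarith
  refine ⟨convex_Ici 0, fun x hx y hy hxy a b ha hb hab => ?_⟩
  simp only [smul_eq_mul]
  rcases eq_or_lt_of_le (show (0 : ℝ) ≤ x from hx) with hx0 | hx0
  · have hy0 : 0 < y := lt_of_le_of_ne hy (hx0 ▸ hxy)
    rw [← hx0]
    simpa using hzero y b hy0 hb (by linarith)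
  rcases eq_or_lt_of_le (show (0 : ℝ) ≤ y from hy) with hy0 | hy0
  · rw [← hy0]
    simpa using hzero x a hx0 ha (by linarith)
  have hτ : 0 < a * x + b * y := by positivity
  have hne : k / x ≠ k / y := by
    intro he
    apply hxy
    field_simp at he
    exact he.symm
  have h1 := h.concave.2 (show k / x ∈ Ioi 0 from div_pos hk hx0)
    (show k / y ∈ Ioi 0 from div_pos hk hy0) hne
    (show 0 < a * x / (a * x + b * y) by positivity)
    (show 0 < b * y / (a * x + b * y) by positivity) (by field_simp)
  simp only [smul_eq_mul] at h1
  have h2 : a * x / (a * x + b * y) * (k / x) + b * y / (a * x + b * y) * (k / y) =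
      k / (a * x + b * y) := by
    have : k = (a + b) * k := by rw [hab, one_mul]
    field_simp
    linarith
  rw [h2] at h1
  have h3 := mul_lt_mul_of_pos_left h1 hτ
  refine lt_of_eq_of_lt ?_ h3
  field_simp

theorem differentiableAt_perspective (h : IsRateCurve r) {k τ : ℝ} (hk : 0 < k) (hτ : 0 < τ) :
    DifferentiableAt ℝ (fun τ => τ * r (k / τ)) τ := by
  have h1 : DifferentiableAt ℝ (fun τ : ℝ => k / τ) τ :=
    (differentiableAt_const k).div differentiableAt_id hτ.ne'
  exact differentiableAt_id.mul (DifferentiableAt.comp τ (h.diff (k / τ) (by positivity)) h1)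

/-- At `0`, put `u = k / τ → ∞`: the perspective is `k r(u) / u`, which tends to zero by sublinear
growth. -/
theorem continuousOn_perspective (h : IsRateCurve r) {k : ℝ} (hk : 0 < k) :
    ContinuousOn (fun τ => τ * r (k / τ)) (Ici 0) := by
  intro τ hτ
  rcases eq_or_lt_of_le (show (0 : ℝ) ≤ τ from hτ) with h0 | h0
  · rw [← h0, ← Ioi_insert, continuousWithinAt_insert_self]
    have h1 : Tendsto (fun τ : ℝ => k / τ) (𝓝[>] 0) atTop :=
      Tendsto.const_mul_atTop hk tendsto_inv_nhdsGT_zero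
    have h2 := (h.lim.comp h1).const_mul k
    rw [mul_zero] at h2
    rw [ContinuousWithinAt, zero_mul]
    refine h2.congr' ?_
    filter_upwards [self_mem_nhdsWithin] with x hx
    have hx' : (0 : ℝ) < x := hx
    simp only [Function.comp_apply]
    field_simp
  · exact (h.differentiableAt_perspective hk h0).continuousAt.continuousWithinAt

end IsRateCurve

/-! ### Maximization of a concave function on the unit interval -/

section

variable {f : ℝ → ℝ} {D t : ℝ}

/-- A concave function may have infinite slope at an endpoint. Maximality bounds the monotone slopes
by `0`, so their supremum is a finite one-sided derivative. -/
theorem hasDerivWithinAt_zero_of_isMaxOn (hf : ConcaveOn ℝ (Icc 0 1) f)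
    (hmax : IsMaxOn f (Icc 0 1) 0) : ∃ D ≤ 0, HasDerivWithinAt f D (Icc 0 1) 0 := by
  have h0 : (0 : ℝ) ∈ Icc (0 : ℝ) 1 := ⟨le_rfl, zero_le_one⟩
  have hanti : AntitoneOn (slope f 0) (Ioo 0 1) :=
    (hf.antitoneOn_slope_gt h0).mono fun x hx => ⟨Ioo_subset_Icc_self hx, hx.1⟩
  have hle : ∀ x ∈ Ioo (0 : ℝ) 1, slope f 0 x ≤ 0 := by
    intro x hx
    rw [slope_def_field]
    have := hmax (Ioo_subset_Icc_self hx)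
    simp only [mem_ofPred_eq] at this
    exact div_nonpos_of_nonpos_of_nonneg (by linarith) (by linarith [hx.1])
  have hb : BddAbove (slope f 0 '' Ioo 0 1) := ⟨0, by rintro _ ⟨x, hx, rfl⟩; exact hle x hx⟩
  refine ⟨sSup (slope f 0 '' Ioo 0 1), Real.sSup_nonpos ?_, ?_⟩
  · rintro _ ⟨x, hx, rfl⟩
    exact hle x hx
  · rw [hasDerivWithinAt_iff_tendsto_slope, Icc_sdiff_left, nhdsWithin_Ioc_eq_nhdsGT zero_lt_one]
    exact hanti.tendsto_nhdsWithin_Ioo_right (by simp) hb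

theorem hasDerivWithinAt_one_of_isMaxOn (hf : ConcaveOn ℝ (Icc 0 1) f)
    (hmax : IsMaxOn f (Icc 0 1) 1) : ∃ D, 0 ≤ D ∧ HasDerivWithinAt f D (Icc 0 1) 1 := by
  have h1 : (1 : ℝ) ∈ Icc (0 : ℝ) 1 := ⟨zero_le_one, le_rfl⟩
  have hanti : AntitoneOn (slope f 1) (Ioo 0 1) :=
    (hf.antitoneOn_slope_lt h1).mono fun x hx => ⟨Ioo_subset_Icc_self hx, hx.2⟩
  have hle : ∀ x ∈ Ioo (0 : ℝ) 1, 0 ≤ slope f 1 x := by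
    intro x hx
    rw [slope_def_field]
    have := hmax (Ioo_subset_Icc_self hx)
    simp only [mem_ofPred_eq] at this
    exact div_nonneg_of_nonpos (by linarith) (by linarith [hx.2])
  have hb : BddBelow (slope f 1 '' Ioo 0 1) := ⟨0, by rintro _ ⟨x, hx, rfl⟩; exact hle x hx⟩
  refine ⟨sInf (slope f 1 '' Ioo 0 1), Real.sInf_nonneg ?_, ?_⟩
  · rintro _ ⟨x, hx, rfl⟩
    exact hle x hx
  · rw [hasDerivWithinAt_iff_tendsto_slope, Icc_sdiff_right, nhdsWithin_Ico_eq_nhdsLT zero_lt_one]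
    exact hanti.tendsto_nhdsWithin_Ioo_left (by simp) hb

theorem le_of_hasDerivWithinAt_nonpos (hf : ConcaveOn ℝ (Icc 0 1) f) (ht : t ∈ Icc (0 : ℝ) 1)
    (h : HasDerivWithinAt f D (Icc 0 1) t) (hD : D ≤ 0) {y : ℝ} (hy : y ∈ Icc (0 : ℝ) 1)
    (hty : t ≤ y) : f y ≤ f t := by
  rcases hty.eq_or_lt with rfl | hlt
  · exact le_rfl
  have h1 := hf.slope_le_of_hasDerivWithinAt ht hy hlt h
  rw [slope_def_field, div_le_iff₀ (by linarith)] at h1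
  nlinarith

theorem le_of_hasDerivWithinAt_nonneg (hf : ConcaveOn ℝ (Icc 0 1) f) (ht : t ∈ Icc (0 : ℝ) 1)
    (h : HasDerivWithinAt f D (Icc 0 1) t) (hD : 0 ≤ D) {y : ℝ} (hy : y ∈ Icc (0 : ℝ) 1)
    (hty : y ≤ t) : f y ≤ f t := by
  rcases hty.eq_or_lt with rfl | hlt
  · exact le_rfl
  have h1 := hf.le_slope_of_hasDerivWithinAt hy ht hlt h
  rw [slope_def_field, le_div_iff₀ (by linarith)] at h1
  nlinarith

theorem isKKT_of_isMaxOn (hf : ConcaveOn ℝ (Icc 0 1) f)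
    (hd : ∀ x ∈ Ioo (0 : ℝ) 1, DifferentiableAt ℝ f x) (ht : t ∈ Icc (0 : ℝ) 1)
    (hmax : IsMaxOn f (Icc 0 1) t) : IsKKT f t := by
  refine ⟨ht, ?_⟩
  rcases ht.1.eq_or_lt with rfl | h0
  · obtain ⟨D, hD, h⟩ := hasDerivWithinAt_zero_of_isMaxOn hf hmax
    exact ⟨D, -D, 0, h, by ring, by linarith, le_rfl, by ring, by ring⟩
  rcases ht.2.eq_or_lt with rfl | h1
  · obtain ⟨D, hD, h⟩ := hasDerivWithinAt_one_of_isMaxOn hf hmax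
    exact ⟨D, 0, D, h, by ring, le_rfl, hD, by ring, by ring⟩
  have h := (hd t ⟨h0, h1⟩).hasDerivAt
  have h2 := (hmax.isLocalMax (Icc_mem_nhds h0 h1)).hasDerivAt_eq_zero h
  exact ⟨0, 0, 0, h2 ▸ h.hasDerivWithinAt, by ring, le_rfl, le_rfl, by ring, by ring⟩

/-- If the maximizer were `0`, the positive derivative would give `f 0 ≤ f t`, hence `t = 0` by
uniqueness; but the derivative at a maximizer `0` is nonpositive. -/
theorem eq_one_of_hasDerivWithinAt_pos (hf : StrictConcaveOn ℝ (Icc 0 1) f) {x : ℝ}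
    (hx : x = 0 ∨ x = 1) (hmax : IsMaxOn f (Icc 0 1) x) (ht : t ∈ Icc (0 : ℝ) 1)
    (h : HasDerivWithinAt f D (Icc 0 1) t) (hD : 0 < D) : x = 1 := by
  rcases hx with rfl | rfl
  · exfalso
    have h0 : (0 : ℝ) ∈ Icc (0 : ℝ) 1 := ⟨le_rfl, zero_le_one⟩
    have h1 := le_of_hasDerivWithinAt_nonneg hf.concaveOn ht h hD.le h0 ht.1
    have h2 : IsMaxOn f (Icc 0 1) t := fun y hy => (hmax hy).trans h1
    have h3 := hf.eq_of_isMaxOn hmax h2 h0 ht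
    subst h3
    obtain ⟨D', hD', h'⟩ := hasDerivWithinAt_zero_of_isMaxOn hf.concaveOn hmax
    have := (uniqueDiffOn_Icc zero_lt_one _ h0).eq_deriv _ h h'
    linarith
  · rfl

theorem eq_zero_of_hasDerivWithinAt_neg (hf : StrictConcaveOn ℝ (Icc 0 1) f) {x : ℝ}
    (hx : x = 0 ∨ x = 1) (hmax : IsMaxOn f (Icc 0 1) x) (ht : t ∈ Icc (0 : ℝ) 1)
    (h : HasDerivWithinAt f D (Icc 0 1) t) (hD : D < 0) : x = 0 := by
  rcases hx with rfl | rfl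
  · rfl
  · exfalso
    have h0 : (1 : ℝ) ∈ Icc (0 : ℝ) 1 := ⟨zero_le_one, le_rfl⟩
    have h1 := le_of_hasDerivWithinAt_nonpos hf.concaveOn ht h hD.le h0 ht.2
    have h2 : IsMaxOn f (Icc 0 1) t := fun y hy => (hmax hy).trans h1
    have h3 := hf.eq_of_isMaxOn hmax h2 h0 ht
    subst h3
    obtain ⟨D', hD', h'⟩ := hasDerivWithinAt_one_of_isMaxOn hf.concaveOn hmax
    have := (uniqueDiffOn_Icc zero_lt_one _ h0).eq_deriv _ h h'
    linarith

end

end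

/-! ### The sensing and communication rates -/

namespace Params

variable (p : Params)

theorem isRegularPrior : IsRegularPrior (bernoulliGaussian p.μT p.σT2 p.γ) (1 - p.γ) :=
  isRegularPrior_bernoulliGaussian p.γ_mem p.target_ne_zero

theorem binInfo_ne_top {s : ℝ} (hs : 0 ≤ s) : p.binInfo s ≠ ⊤ := by
  have h := p.isRegularPrior
  have := h.prob
  exact (mutualInfo_channelLaw hs h.moment h.pos (h.le s hs)).1

theorem toReal_binInfo {s : ℝ} (hs : 0 ≤ s) :
    (p.binInfo s).toReal = s * ∫ x, ‖x‖ ^ 2 ∂(bernoulliGaussian p.μT p.σT2 p.γ) -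
      outputDiv (bernoulliGaussian p.μT p.σT2 p.γ) s := by
  have h := p.isRegularPrior
  have := h.prob
  exact (mutualInfo_channelLaw hs h.moment h.pos (h.le s hs)).2

theorem isRateCurve_binRate : IsRateCurve p.binRate := by
  have hP := p.isRegularPrior
  set P := bernoulliGaussian p.μT p.σT2 p.γ with hPdef
  set v := ∫ x, ‖x‖ ^ 2 ∂P with hv
  have hv0 : 0 ≤ v := integral_nonneg fun x => by positivity
  have heq : ∀ s, 0 < s → (p.binInfo s).toReal = s * v - outputDiv P s := fun s hs =>
    p.toReal_binInfo hs.le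
  have hd : ∀ s, 0 < s → DifferentiableAt ℝ (fun s => (p.binInfo s).toReal) s := by
    intro s hs
    have h1 : DifferentiableAt ℝ (fun s => s * v - outputDiv P s) s :=
      (differentiableAt_id.mul_const v).sub (differentiableAt_outputDiv _ _ p.γ_mem hs)
    refine h1.congr_of_eventuallyEq ?_
    filter_upwards [lt_mem_nhds hs] with u hu using heq u hu
  have hlog2 : 0 < Real.log 2 := Real.log_pos one_lt_two
  refine IsRateCurve.div_const (r := fun s => (p.binInfo s).toReal) ⟨fun s _ => ENNReal.toReal_nonneg,
    strictConcaveOn_of_increments hd fun s t u hs ht hu => ?_, hd,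
    tendsto_div_of_le_log (C := 1) hv0 (fun s _ => ENNReal.toReal_nonneg) fun s hs => ?_⟩ hlog2
  · rw [heq _ (by positivity), heq _ hs, heq _ (by positivity), heq _ (by positivity)]
    have := hP.outputDiv_add_lt_add hs ht hu
    linarith
  · rw [heq _ hs]
    have := hP.le_outputDiv hs
    linarith

theorem isRateCurve_logb : IsRateCurve fun s => Real.logb 2 (1 + s) :=
  isRateCurve_log.div_const (Real.log_pos one_lt_two)

/-- The identity holds for all real `t`, including `t = 0`, where division by zero yields `0` on
both sides and the factor `t` kills the rate. -/
theorem exists_rateS_eq :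
    ∃ k : ℝ, 0 < k ∧ p.rateS = fun t => p.B * (t * p.binRate (k / t)) := by
  have h1 := p.B_pos
  have h2 := p.N₀_pos
  have h3 := p.Pt_pos
  have h4 := p.Gt_pos
  have h5 := p.σrcs_pos
  have h6 := p.Aeff_pos
  have h7 := p.d_pos
  have h8 : (0 : ℝ) < p.M := by exact_mod_cast p.M_pos
  refine ⟨p.M / (p.B * p.N₀) * (p.Pt * p.Gt * p.σrcs * p.Aeff / ((4 * Real.pi) ^ 2 * p.d ^ 4)),
    by positivity, funext fun t => ?_⟩
  have : p.snrS t = p.M / (p.B * p.N₀) *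
      (p.Pt * p.Gt * p.σrcs * p.Aeff / ((4 * Real.pi) ^ 2 * p.d ^ 4)) / t := by
    rw [snrS, mul_assoc t, mul_comm t, ← div_div]
    ring
  rw [rateS, this]
  ring

theorem exists_rateC_eq :
    ∃ k : ℝ, 0 < k ∧ p.rateC = fun t => p.B * ((1 - t) * Real.logb 2 (1 + k / (1 - t))) := by
  have h1 := p.B_pos
  have h2 := p.N₀_pos
  have h3 := p.Pt_pos
  refine ⟨p.Pt / (p.B * p.N₀), by positivity, funext fun t => ?_⟩
  have : p.snrC t = p.Pt / (p.B * p.N₀) / (1 - t) := by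
    rw [snrC, mul_assoc, div_div, mul_comm]
  rw [rateC, this]
  ring

theorem differentiableAt_rateS {t : ℝ} (ht : t ∈ Ioo (0 : ℝ) 1) : DifferentiableAt ℝ p.rateS t := by
  obtain ⟨k, hk, h⟩ := p.exists_rateS_eq
  rw [h]
  exact (p.isRateCurve_binRate.differentiableAt_perspective hk ht.1).const_mul _

theorem differentiableAt_rateC {t : ℝ} (ht : t ∈ Ioo (0 : ℝ) 1) : DifferentiableAt ℝ p.rateC t := by
  obtain ⟨k, hk, h⟩ := p.exists_rateC_eq
  rw [h]
  have h1 := isRateCurve_logb.differentiableAt_perspective hk (sub_pos.mpr ht.2)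
  exact (DifferentiableAt.comp t h1 (differentiableAt_id.const_sub 1)).const_mul _

theorem continuousOn_rateS : ContinuousOn p.rateS (Icc 0 1) := by
  obtain ⟨k, hk, h⟩ := p.exists_rateS_eq
  rw [h]
  exact ((p.isRateCurve_binRate.continuousOn_perspective hk).mono Icc_subset_Ici_self).const_mul _

theorem continuousOn_rateC : ContinuousOn p.rateC (Icc 0 1) := by
  obtain ⟨k, hk, h⟩ := p.exists_rateC_eq
  rw [h]
  refine ContinuousOn.const_mul ?_ _
  refine (isRateCurve_logb.continuousOn_perspective hk).comp (f := fun t => 1 - t) (by fun_prop) ?_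
  intro t ht
  exact sub_nonneg.mpr ht.2

theorem strictMonoOn_rateS : StrictMonoOn p.rateS (Icc 0 1) := by
  obtain ⟨k, hk, h⟩ := p.exists_rateS_eq
  rw [h]
  intro a ha b hb hab
  exact mul_lt_mul_of_pos_left
    (p.isRateCurve_binRate.strictMonoOn_perspective hk ha.1 hb.1 hab) p.B_pos

theorem strictAntiOn_rateC : StrictAntiOn p.rateC (Icc 0 1) := by
  obtain ⟨k, hk, h⟩ := p.exists_rateC_eq
  rw [h]
  intro a ha b hb hab
  exact mul_lt_mul_of_pos_left
    (isRateCurve_logb.strictMonoOn_perspective hk (sub_nonneg.mpr hb.2) (sub_nonneg.mpr ha.2)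
      (sub_lt_sub_left hab 1)) p.B_pos

theorem strictConcaveOn_rateS : StrictConcaveOn ℝ (Icc 0 1) p.rateS := by
  obtain ⟨k, hk, h⟩ := p.exists_rateS_eq
  rw [h]
  refine ⟨convex_Icc 0 1, fun x hx y hy hxy a b ha hb hab => ?_⟩
  have h1 := (p.isRateCurve_binRate.strictConcaveOn_perspective hk).2 (show x ∈ Ici 0 from hx.1)
    (show y ∈ Ici 0 from hy.1) hxy ha hb hab
  have h2 := mul_lt_mul_of_pos_left h1 p.B_pos
  simp only [smul_eq_mul] at h2 ⊢
  linarith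

theorem strictConcaveOn_rateC : StrictConcaveOn ℝ (Icc 0 1) p.rateC := by
  obtain ⟨k, hk, h⟩ := p.exists_rateC_eq
  rw [h]
  refine ⟨convex_Icc 0 1, fun x hx y hy hxy a b ha hb hab => ?_⟩
  have h1 := (isRateCurve_logb.strictConcaveOn_perspective hk).2
    (show 1 - x ∈ Ici 0 from sub_nonneg.mpr hx.2) (show 1 - y ∈ Ici 0 from sub_nonneg.mpr hy.2)
    (by intro he; exact hxy (by linarith)) ha hb hab
  have h2 := mul_lt_mul_of_pos_left h1 p.B_pos
  simp only [smul_eq_mul] at h2 ⊢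
  rw [show a * (1 - x) + b * (1 - y) = 1 - (a * x + b * y) by linear_combination hab] at h2
  linarith

variable {ws wc : ℝ}

/-- One weight may vanish, so strict concavity of both individual rates is needed. -/
theorem strictConcaveOn_rateSum (hws : 0 ≤ ws) (hwc : 0 ≤ wc) (hw : 0 < ws + wc) :
    StrictConcaveOn ℝ (Icc 0 1) (p.rateSum ws wc) := by
  refine ⟨convex_Icc 0 1, fun x hx y hy hxy a b ha hb hab => ?_⟩
  have h1 := p.strictConcaveOn_rateS.2 hx hy hxy ha hb hab
  have h2 := p.strictConcaveOn_rateC.2 hx hy hxy ha hb hab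
  simp only [smul_eq_mul, rateSum] at h1 h2 ⊢
  rcases hws.eq_or_lt with rfl | hs
  · have := mul_lt_mul_of_pos_left h2 (show 0 < wc by linarith)
    linarith
  · have := mul_lt_mul_of_pos_left h1 hs
    have := mul_le_mul_of_nonneg_left h2.le hwc
    linarith

theorem continuousOn_rateSum (ws wc : ℝ) : ContinuousOn (p.rateSum ws wc) (Icc 0 1) :=
  (p.continuousOn_rateS.const_mul ws).add (p.continuousOn_rateC.const_mul wc)

theorem hasDerivWithinAt_rateSum {a b t : ℝ} {S : Set ℝ} (ha : HasDerivWithinAt p.rateS a S t)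
    (hb : HasDerivWithinAt p.rateC b S t) :
    HasDerivWithinAt (p.rateSum ws wc) (ws * a + wc * b) S t :=
  (ha.const_mul ws).add (hb.const_mul wc)

theorem differentiableAt_rateSum {t : ℝ} (ht : t ∈ Ioo (0 : ℝ) 1) :
    DifferentiableAt ℝ (p.rateSum ws wc) t :=
  ((p.differentiableAt_rateS ht).const_mul ws).add ((p.differentiableAt_rateC ht).const_mul wc)

theorem IsStationary.isMaxOn {p : Params} {t : ℝ} (hws : 0 ≤ ws) (hwc : 0 ≤ wc) (hw : 0 < ws + wc)
    (h : p.IsStationary ws wc t) : IsMaxOn (p.rateSum ws wc) (Icc 0 1) t := by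
  obtain ⟨ht, a, b, ha, hb, h0⟩ := h
  have hc := (p.strictConcaveOn_rateSum hws hwc hw).concaveOn
  have hd := p.hasDerivWithinAt_rateSum (ws := ws) (wc := wc) ha hb
  intro y hy
  rcases le_total t y with hty | hty
  · exact le_of_hasDerivWithinAt_nonpos hc ht hd h0.le hy hty
  · exact le_of_hasDerivWithinAt_nonneg hc ht hd h0.ge hy hty

theorem isStationary_of_isMaxOn {t : ℝ} (ht : t ∈ Ioo (0 : ℝ) 1)
    (hmax : IsMaxOn (p.rateSum ws wc) (Icc 0 1) t) : p.IsStationary ws wc t := by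
  have hS := (p.differentiableAt_rateS ht).hasDerivAt
  have hC := (p.differentiableAt_rateC ht).hasDerivAt
  refine ⟨Ioo_subset_Icc_self ht, _, _, hS.hasDerivWithinAt, hC.hasDerivWithinAt, ?_⟩
  exact (hmax.isLocalMax (Icc_mem_nhds ht.1 ht.2)).hasDerivAt_eq_zero
    ((hS.const_mul ws).add (hC.const_mul wc))

end Params

end ISAC

end

/-! ### The main theorem -/

theorem theorem5 (p : ISAC.Params) (ws wc : ℝ) (hws : 0 ≤ ws) (hwc : 0 ≤ wc)
    (hw : 0 < ws + wc) :
    -- the mutual information that defines the sensing rate is finite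
    (∀ s : ℝ, 0 ≤ s → p.binInfo s ≠ ⊤) ∧
    -- both rates are differentiable in the open interval
    (∀ t ∈ Set.Ioo (0 : ℝ) 1, DifferentiableAt ℝ p.rateS t ∧ DifferentiableAt ℝ p.rateC t) ∧
    -- the optimal ratio `tstar`: existence, uniqueness, and the conditions that determine it
    (∃ tstar ∈ Set.Icc (0 : ℝ) 1,
      (∀ t ∈ Set.Icc (0 : ℝ) 1,
        IsMaxOn (p.rateSum ws wc) (Set.Icc (0 : ℝ) 1) t ↔ t = tstar) ∧
      ISAC.IsKKT (p.rateSum ws wc) tstar ∧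
      (∀ t : ℝ, p.IsStationary ws wc t → t = tstar) ∧
      ((¬ ∃ t : ℝ, p.IsStationary ws wc t) →
        (∀ t ∈ Set.Icc (0 : ℝ) 1, ∀ a b : ℝ,
          HasDerivWithinAt p.rateS a (Set.Icc 0 1) t →
          HasDerivWithinAt p.rateC b (Set.Icc 0 1) t →
          (ws * a > -(wc * b) → tstar = 1) ∧ (ws * a < -(wc * b) → tstar = 0)) ∧
        ((∀ t ∈ Set.Ioo (0 : ℝ) 1, ws * deriv p.rateS t > -(wc * deriv p.rateC t)) ∨
          (∀ t ∈ Set.Ioo (0 : ℝ) 1, ws * deriv p.rateS t < -(wc * deriv p.rateC t))))) ∧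
    -- shape of the two rates
    StrictMonoOn p.rateS (Set.Icc (0 : ℝ) 1) ∧ ConcaveOn ℝ (Set.Icc (0 : ℝ) 1) p.rateS ∧
    StrictAntiOn p.rateC (Set.Icc (0 : ℝ) 1) ∧ ConcaveOn ℝ (Set.Icc (0 : ℝ) 1) p.rateC := by
  have hconc := p.strictConcaveOn_rateSum hws hwc hw
  obtain ⟨x, hx, hmax⟩ := isCompact_Icc.exists_isMaxOn (Set.nonempty_Icc.mpr zero_le_one)
    (p.continuousOn_rateSum ws wc)
  have huniq : ∀ t ∈ Set.Icc (0 : ℝ) 1,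
      IsMaxOn (p.rateSum ws wc) (Set.Icc (0 : ℝ) 1) t ↔ t = x := fun t ht =>
    ⟨fun h => hconc.eq_of_isMaxOn h hmax ht hx, fun h => h ▸ hmax⟩
  refine ⟨fun s hs => p.binInfo_ne_top hs,
    fun t ht => ⟨p.differentiableAt_rateS ht, p.differentiableAt_rateC ht⟩,
    ⟨x, hx, huniq, ?_, ?_, ?_⟩, p.strictMonoOn_rateS, p.strictConcaveOn_rateS.concaveOn,
    p.strictAntiOn_rateC, p.strictConcaveOn_rateC.concaveOn⟩
  · exact ISAC.isKKT_of_isMaxOn hconc.concaveOn (fun t ht => p.differentiableAt_rateSum ht) hx hmax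
  · exact fun t ht => (huniq t ht.1).mp (ht.isMaxOn hws hwc hw)
  · intro hno
    have hend : x = 0 ∨ x = 1 := by
      by_contra! hne
      exact hno ⟨x, p.isStationary_of_isMaxOn
        ⟨lt_of_le_of_ne hx.1 hne.1.symm, lt_of_le_of_ne hx.2 hne.2⟩ hmax⟩
    have hsign : ∀ t ∈ Set.Icc (0 : ℝ) 1, ∀ a b : ℝ,
        HasDerivWithinAt p.rateS a (Set.Icc 0 1) t → HasDerivWithinAt p.rateC b (Set.Icc 0 1) t →
        (ws * a > -(wc * b) → x = 1) ∧ (ws * a < -(wc * b) → x = 0) := by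
      intro t ht a b ha hb
      have hd := p.hasDerivWithinAt_rateSum (ws := ws) (wc := wc) ha hb
      exact ⟨fun h => ISAC.eq_one_of_hasDerivWithinAt_pos hconc hend hmax ht hd (by linarith),
        fun h => ISAC.eq_zero_of_hasDerivWithinAt_neg hconc hend hmax ht hd (by linarith)⟩
    refine ⟨hsign, ?_⟩
    -- The sign at each interior point determines which endpoint is the maximizer. Since the
    -- maximizer `x` is fixed, the sign is the same throughout, with no appeal to continuity of the
    -- derivatives.
    have hlt : ∀ t ∈ Set.Ioo (0 : ℝ) 1, (ws * deriv p.rateS t > -(wc * deriv p.rateC t) ∧ x = 1) ∨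
        (ws * deriv p.rateS t < -(wc * deriv p.rateC t) ∧ x = 0) := by
      intro t ht
      have ht' := Set.Ioo_subset_Icc_self ht
      have hS := (p.differentiableAt_rateS ht).hasDerivAt.hasDerivWithinAt (s := Set.Icc 0 1)
      have hC := (p.differentiableAt_rateC ht).hasDerivAt.hasDerivWithinAt (s := Set.Icc 0 1)
      obtain ⟨h1, h0⟩ := hsign t ht' _ _ hS hC
      rcases lt_trichotomy (ws * deriv p.rateS t) (-(wc * deriv p.rateC t)) with h | h | h
      · exact Or.inr ⟨h, h0 h⟩
      · exact absurd ⟨t, ht', _, _, hS, hC, by linarith⟩ hno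
      · exact Or.inl ⟨h, h1 h⟩
    rcases hend with h | h
    · refine Or.inr fun t ht => ?_
      rcases hlt t ht with h' | h'
      · exact absurd (h.symm.trans h'.2) zero_ne_one
      · exact h'.1
    · refine Or.inl fun t ht => ?_
      rcases hlt t ht with h' | h'
      · exact h'.1
      · exact absurd (h'.2.symm.trans h) zero_ne_one
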